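/- Let $M$ be the monoid defined by the presentation with generators $a, a^{-1}, b, b^{-1}, h$ (five symbols) and defining relations $$aa^{-1}=a^{-1}a=bb^{-1}=b^{-1}b=1,\qquad xh=hx,\quad hxy=hyx,\quad h^2x=h^2\quad (x,y\in\{a,a^{-1},b,b^{-1}\}),\qquad h^3=h^2 .$$ Elements $s,t$ of a monoid $S$ are $\mathcal H$-related if $sS=tS$ and $Ss=St$. The Schützenberger group of an $\mathcal H$-class $H$ is the quotient of $\mathrm{Stab}(H)=\{s\in S: Hs=H\}$ by the congruence $\{(s,t): xs=xt\}$, where $x\in H$ is fixed; up to isomorphism it does not depend on $x$. A monoid is presentable by a finite complete rewriting system if it has a presentation $\langle A\mid R\rangle$ with $A$ and $R$ finite such that the string rewriting system $R$ admits no infinite reduction sequence and is confluent. A monoid has finite derivation type (FDT) if it has a finite presentation $\langle A\mid R\rangle$ whose derivation graph (vertices: the words over $A$; edges $(w_1,r,\epsilon,w_2)$ from $w_1r_\epsilon w_2$ to $w_1r_{-\epsilon}w_2$, for $r=(r_{+1},r_{-1})\in R$, $\epsilon=\pm1$, $w_1,w_2\in A^*$) has a finite homotopy base. A homotopy base is a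 set $C$ of pairs of parallel paths such that every two parallel paths are related by the smallest equivalence relation on parallel paths that contains $C$, is compatible with composition of paths and with the two-sided action of $A^*$, relates $p\circ p^{-1}$ to the empty path for every path $p$, and relates $(e_1\cdot\iota e_2)\circ(\tau e_1\cdot e_2)$ to $(\iota e_1\cdot e_2)\circ(e_1\cdot\tau e_2)$ for all edges $e_1,e_2$, where $\iota e$ and $\tau e$ are the initial and terminal vertices of $e$. Theorem. (i) $M$ has exactly three $\mathcal H$-classes, and their Schützenberger groups are isomorphic to the trivial group, the free abelian group of rank two, and the free group of rank two, respectively. In particular, all Schützenberger groups of $M$ are presentable by finite complete rewriting systems and have finite derivation type. (ii) $M$ does not have finite derivation type, and it is not presentable by a finite complete rewriting system. -/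

import Mathlib

universe u v

/-! ### Rewriting systems and monoid presentations -/

/-- The monoid defined by the presentation `⟨A | R⟩`: the quotient of the free monoid on `A` by the
congruence generated by `R`. -/
abbrev MonoidOf {A : Type u} (R : Set (FreeMonoid A × FreeMonoid A)) : Type u :=
  PresentedMonoid fun x y => (x, y) ∈ R

/-- One-step reduction: `w₁ r₊ w₂ → w₁ r₋ w₂` for a rule `(r₊, r₋) ∈ R`. -/
def Rewrites {A : Type u} (R : Set (FreeMonoid A × FreeMonoid A)) (x y : FreeMonoid A) : Prop :=
  ∃ r ∈ R, ∃ w₁ w₂ : FreeMonoid A, x = w₁ * r.1 * w₂ ∧ y = w₁ * r.2 * w₂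

/-- There is no infinite reduction sequence. -/
def IsNoetherianRewriting {A : Type u} (R : Set (FreeMonoid A × FreeMonoid A)) : Prop :=
  ¬ ∃ f : ℕ → FreeMonoid A, ∀ n, Rewrites R (f n) (f (n + 1))

/-- Whenever `w` reduces to both `x` and `y`, these have a common descendant. -/
def IsConfluent {A : Type u} (R : Set (FreeMonoid A × FreeMonoid A)) : Prop :=
  ∀ w x y : FreeMonoid A, Relation.ReflTransGen (Rewrites R) w x →
    Relation.ReflTransGen (Rewrites R) w y →
    ∃ z, Relation.ReflTransGen (Rewrites R) x z ∧ Relation.ReflTransGen (Rewrites R) y z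

/-- A complete rewriting system: noetherian and confluent. -/
def IsCompleteRewriting {A : Type u} (R : Set (FreeMonoid A × FreeMonoid A)) : Prop :=
  IsNoetherianRewriting R ∧ IsConfluent R

/-- The monoid `S` has a presentation by a finite complete rewriting system. -/
def HasFiniteCompleteRewriting (S : Type v) [Monoid S] : Prop :=
  ∃ (A : Type) (R : Set (FreeMonoid A × FreeMonoid A)),
    Finite A ∧ R.Finite ∧ IsCompleteRewriting R ∧ Nonempty (MonoidOf R ≃* S)

/-! ### Derivation graphs and homotopy bases -/

/-- The vertex set of the derivation graph of `⟨A | R⟩`: all words over `A`. -/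
def DerivationGraph {A : Type u} (_R : Set (FreeMonoid A × FreeMonoid A)) : Type u := FreeMonoid A

namespace DerivationGraph

variable {A : Type u} {R : Set (FreeMonoid A × FreeMonoid A)}

instance : Monoid (DerivationGraph R) := inferInstanceAs (Monoid (FreeMonoid A))

/-- The side of the rule `r = (r₊, r₋)` of the given sign (`true` is `+1`, `false` is `-1`). -/
def side (r : R) (ε : Bool) : DerivationGraph R := if ε then r.1.1 else r.1.2

/-- An edge `(w₁, r, ε, w₂)` with initial vertex `x = w₁ r_ε w₂` and terminal vertex
`y = w₁ r_{-ε} w₂`. -/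
@[ext]
structure Edge (x y : DerivationGraph R) : Type u where
  left : DerivationGraph R
  rule : R
  sign : Bool
  right : DerivationGraph R
  initial_eq : x = left * side rule sign * right
  terminal_eq : y = left * side rule (!sign) * right

instance : Quiver (DerivationGraph R) := ⟨Edge⟩

/-- The inverse edge `(w₁, r, -ε, w₂)`. -/
def Edge.inv {x y : DerivationGraph R} (e : Edge x y) : Edge y x where
  left := e.left
  rule := e.rule
  sign := !e.sign
  right := e.right
  initial_eq := e.terminal_eq
  terminal_eq := by rw [Bool.not_not]; exact e.initial_eq

instance : Quiver.HasInvolutiveReverse (DerivationGraph R) where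
  reverse' e := e.inv
  inv' e := Edge.ext rfl rfl (Bool.not_not e.sign) rfl

/-- The left action of the word `w` on edges: `w · (w₁, r, ε, w₂) = (w w₁, r, ε, w₂)`. -/
def edgeLeft (w : DerivationGraph R) {x y : DerivationGraph R} (e : x ⟶ y) : w * x ⟶ w * y :=
  Edge.mk (w * Edge.left e) (Edge.rule e) (Edge.sign e) (Edge.right e)
    ((congrArg (w * ·) (Edge.initial_eq e)).trans (by simp only [mul_assoc]))
    ((congrArg (w * ·) (Edge.terminal_eq e)).trans (by simp only [mul_assoc]))

/-- The right action of the word `w` on edges: `(w₁, r, ε, w₂) · w = (w₁, r, ε, w₂ w)`. -/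
def edgeRight {x y : DerivationGraph R} (e : x ⟶ y) (w : DerivationGraph R) : x * w ⟶ y * w :=
  Edge.mk (Edge.left e) (Edge.rule e) (Edge.sign e) (Edge.right e * w)
    ((congrArg (· * w) (Edge.initial_eq e)).trans (by simp only [mul_assoc]))
    ((congrArg (· * w) (Edge.terminal_eq e)).trans (by simp only [mul_assoc]))

/-- The two-sided action `e ↦ w · e · z` of the free monoid on the graph; it acts on paths through
`Prefunctor.mapPath`. -/
def act (w z : DerivationGraph R) : DerivationGraph R ⥤q DerivationGraph R where
  obj x := w * x * z
  map e := edgeRight (edgeLeft w e) z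

/-- A homotopy relation on the paths of the derivation graph. Two paths are parallel precisely when
they lie in the same type `Quiver.Path x y`, so a relation contained in parallelism is a family of
relations, one on each of these types. -/
structure IsHomotopyRelation
    (r : ∀ ⦃x y : DerivationGraph R⦄, Quiver.Path x y → Quiver.Path x y → Prop) : Prop where
  equivalence : ∀ x y : DerivationGraph R, Equivalence (@r x y)
  /-- `(e₁ · ιe₂) ∘ (τe₁ · e₂) ∼ (ιe₁ · e₂) ∘ (e₁ · τe₂)` -/
  interchange : ∀ {x₁ y₁ x₂ y₂ : DerivationGraph R} (e₁ : x₁ ⟶ y₁) (e₂ : x₂ ⟶ y₂),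
    r ((edgeRight e₁ x₂).toPath.comp (edgeLeft y₁ e₂).toPath)
      ((edgeLeft x₁ e₂).toPath.comp (edgeRight e₁ y₂).toPath)
  /-- compatibility with the two-sided action of the free monoid -/
  act : ∀ {x y : DerivationGraph R} (p q : Quiver.Path x y) (w z : DerivationGraph R),
    r p q → r ((DerivationGraph.act w z).mapPath p) ((DerivationGraph.act w z).mapPath q)
  /-- compatibility with composition -/
  comp : ∀ {x' x y y' : DerivationGraph R} (s : Quiver.Path x' x) (p q : Quiver.Path x y)
    (t : Quiver.Path y y'), r p q → r ((s.comp p).comp t) ((s.comp q).comp t)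
  /-- `p ∘ p⁻¹ ∼ 1` -/
  inv : ∀ {x y : DerivationGraph R} (p : Quiver.Path x y), r (p.comp p.reverse) Quiver.Path.nil

/-- The type of pairs of parallel paths of the derivation graph. -/
abbrev ParallelPair (R : Set (FreeMonoid A × FreeMonoid A)) : Type u :=
  Σ x y : DerivationGraph R, Quiver.Path x y × Quiver.Path x y

/-- The homotopy relation generated by `C`, the smallest one that contains `C`. -/
def Homotopic (C : Set (ParallelPair R)) {x y : DerivationGraph R} (p q : Quiver.Path x y) : Prop :=
  ∀ r : ∀ ⦃x y : DerivationGraph R⦄, Quiver.Path x y → Quiver.Path x y → Prop,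
    IsHomotopyRelation r → (∀ c ∈ C, r c.2.2.1 c.2.2.2) → r p q

/-- `C` is a homotopy base: the homotopy relation that it generates is parallelism. -/
def IsHomotopyBase (C : Set (ParallelPair R)) : Prop :=
  ∀ ⦃x y : DerivationGraph R⦄ (p q : Quiver.Path x y), Homotopic C p q

end DerivationGraph

/-- The presentation `⟨A | R⟩` has finite derivation type. -/
def PresentationFDT {A : Type u} (R : Set (FreeMonoid A × FreeMonoid A)) : Prop :=
  ∃ C : Set (DerivationGraph.ParallelPair R), C.Finite ∧ DerivationGraph.IsHomotopyBase C

/-- The monoid `S` has finite derivation type: it has a finite presentation which has finite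
derivation type. -/
def HasFDT (S : Type v) [Monoid S] : Prop :=
  ∃ (A : Type) (R : Set (FreeMonoid A × FreeMonoid A)),
    Finite A ∧ R.Finite ∧ Nonempty (MonoidOf R ≃* S) ∧ PresentationFDT R

/-! ### Green's relations and Schützenberger groups -/

section Green

variable {S : Type v} [Monoid S]

/-- Green's relation `R`: `xS = yS`. -/
def GreenR (x y : S) : Prop := Set.range (fun s => x * s) = Set.range (fun s => y * s)

/-- Green's relation `L`: `Sx = Sy`. -/
def GreenL (x y : S) : Prop := Set.range (fun s => s * x) = Set.range (fun s => s * y)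

/-- Green's relation `H`, the intersection of `R` and `L`. -/
def GreenH (x y : S) : Prop := GreenR x y ∧ GreenL x y

/-- The `H`-class of `x`. -/
def hClass (x : S) : Set S := {y | GreenH y x}

/-- `H` is an `H`-class of `S`. -/
def IsHClass (H : Set S) : Prop := ∃ x : S, H = hClass x

theorem greenR_iff {x y : S} : GreenR x y ↔ (∃ s, x * s = y) ∧ ∃ s, y * s = x := by
  constructor
  · intro h
    unfold GreenR at h
    constructor
    · have : y ∈ Set.range (fun s => y * s) := ⟨1, mul_one y⟩
      rw [← h] at this; exact this
    · have : x ∈ Set.range (fun s => x * s) := ⟨1, mul_one x⟩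
      rw [h] at this; exact this
  · rintro ⟨⟨s, rfl⟩, t, ht⟩
    apply Set.Subset.antisymm
    · rintro _ ⟨w, rfl⟩
      exact ⟨t * w, by simp only [← mul_assoc, ht]⟩
    · rintro _ ⟨w, rfl⟩
      exact ⟨s * w, by simp only [← mul_assoc]⟩

theorem greenL_iff {x y : S} : GreenL x y ↔ (∃ s, s * x = y) ∧ ∃ s, s * y = x := by
  constructor
  · intro h
    unfold GreenL at h
    constructor
    · have : y ∈ Set.range (fun s => s * y) := ⟨1, one_mul y⟩
      rw [← h] at this; exact this
    · have : x ∈ Set.range (fun s => s * x) := ⟨1, one_mul x⟩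
      rw [h] at this; exact this
  · rintro ⟨⟨s, rfl⟩, t, ht⟩
    apply Set.Subset.antisymm
    · rintro _ ⟨w, rfl⟩
      exact ⟨w * t, by simp only [mul_assoc, ht]⟩
    · rintro _ ⟨w, rfl⟩
      exact ⟨w * s, by simp only [mul_assoc]⟩

theorem mem_hClass_self (x : S) : x ∈ hClass x := ⟨rfl, rfl⟩

/-- The right setwise stabiliser `Stab(H) = {s | Hs = H}` of the `H`-class `H` of `x`. -/
def hStab (x : S) : Submonoid S where
  carrier := {s | (fun y => y * s) '' hClass x = hClass x}
  one_mem' := by simp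
  mul_mem' := by
    intro s t hs ht
    have hs' : (fun y => y * s) '' hClass x = hClass x := hs
    have ht' : (fun y => y * t) '' hClass x = hClass x := ht
    change (fun y => y * (s * t)) '' hClass x = hClass x
    calc (fun y => y * (s * t)) '' hClass x
        = (fun y => y * t) '' ((fun y => y * s) '' hClass x) := by
          rw [Set.image_image]; simp only [mul_assoc]
      _ = hClass x := by rw [hs', ht']

theorem mul_mem_hClass {x y s : S} (hs : s ∈ hStab x) (hy : y ∈ hClass x) : y * s ∈ hClass x := by
  have h : (fun y => y * s) '' hClass x = hClass x := hs
  rw [← h]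
  exact ⟨y, hy, rfl⟩

/-- The Schützenberger congruence `{(s, t) | xs = xt}` on the stabiliser of the `H`-class of `x`. -/
def schutzenbergerCon (x : S) : Con (hStab x) where
  r s t := x * (s : S) = x * (t : S)
  iseqv := ⟨fun _ => rfl, fun h => h.symm, fun h h' => h.trans h'⟩
  mul' := by
    intro s t s' t' h h'
    obtain ⟨-, w, hw⟩ := greenL_iff.1 (mul_mem_hClass t.2 (mem_hClass_self x)).2
    simp only [Submonoid.coe_mul, ← mul_assoc, h]
    rw [← hw, mul_assoc, mul_assoc, h']

/-- The Schützenberger group of the `H`-class of `x`. -/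
abbrev SchutzenbergerGroup (x : S) : Type v := (schutzenbergerCon x).Quotient

theorem exists_hStab_inv (x : S) (s : hStab x) :
    ∃ t : hStab x, x * (t : S) * (s : S) = x := by
  have hs : (fun y => y * (s : S)) '' hClass x = hClass x := s.2
  obtain ⟨t, ht⟩ := (greenR_iff.1 (mul_mem_hClass s.2 (mem_hClass_self x)).1).1
  have hst : ∀ z ∈ hClass x, z * (s : S) * t = z := by
    intro z hz
    obtain ⟨w, hw⟩ := (greenL_iff.1 hz.2).2
    rw [← hw, mul_assoc w, mul_assoc w, ht]
  have himg : (fun y => y * t) '' hClass x = hClass x := by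
    conv_lhs => rw [← hs]
    rw [Set.image_image]
    ext z
    constructor
    · rintro ⟨y, hy, rfl⟩
      simpa only [hst y hy] using hy
    · intro hz
      exact ⟨z, hz, hst z hz⟩
  refine ⟨⟨t, himg⟩, ?_⟩
  have hx : x ∈ (fun y => y * (s : S)) '' hClass x := by rw [hs]; exact mem_hClass_self x
  obtain ⟨y, hy, hyx⟩ := hx
  have hyx' : y * (s : S) = x := hyx
  change x * t * (s : S) = x
  calc x * t * (s : S) = y * (s : S) * t * (s : S) := by rw [hyx']
    _ = y * (s : S) := by rw [hst y hy]
    _ = x := hyx'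

theorem exists_left_inv (x : S) (g : SchutzenbergerGroup x) :
    ∃ g' : SchutzenbergerGroup x, g' * g = 1 := by
  induction g using Con.induction_on with
  | H s =>
    obtain ⟨t, ht⟩ := exists_hStab_inv x s
    refine ⟨(t : SchutzenbergerGroup x), ?_⟩
    rw [← Con.coe_mul, ← Con.coe_one, Con.eq]
    change x * ((t : S) * (s : S)) = x * 1
    rw [mul_one, ← mul_assoc, ht]

noncomputable instance (x : S) : Group (SchutzenbergerGroup x) :=
  { (inferInstance : Monoid (SchutzenbergerGroup x)) with
    inv := fun g => Classical.choose (exists_left_inv x g)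
    inv_mul_cancel := fun g => Classical.choose_spec (exists_left_inv x g) }

end Green

/-! ### The monoid `M` -/

/-- The generators `a, a⁻¹, b, b⁻¹, h`. -/
inductive Gen : Type
  | a | a' | b | b' | h

namespace Gen

/-- The generators `a, a⁻¹, b, b⁻¹` as words. -/
def units : Set (FreeMonoid Gen) :=
  {FreeMonoid.of a, FreeMonoid.of a', FreeMonoid.of b, FreeMonoid.of b'}

/-- The generator `h` as a word. -/
def H : FreeMonoid Gen := FreeMonoid.of h

/-- The defining relations of `M`. -/
def relations : Set (FreeMonoid Gen × FreeMonoid Gen) :=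
  {(FreeMonoid.of a * FreeMonoid.of a', 1), (FreeMonoid.of a' * FreeMonoid.of a, 1),
    (FreeMonoid.of b * FreeMonoid.of b', 1), (FreeMonoid.of b' * FreeMonoid.of b, 1)} ∪
  {p | ∃ x ∈ units, p = (x * H, H * x)} ∪
  {p | ∃ x ∈ units, ∃ y ∈ units, p = (H * x * y, H * y * x)} ∪
  {p | ∃ x ∈ units, p = (H ^ 2 * x, H ^ 2)} ∪
  {(H ^ 3, H ^ 2)}

end Gen

/-- The monoid `M`. -/
abbrev MonoidM : Type := MonoidOf Gen.relations

/-!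
The monoid `M` is isomorphic to `F ⊔ Fᵃᵇ ⊔ {0}`, where `F` is the free group on `a` and `b`, the
generator `h` is the identity of `Fᵃᵇ`, the group `F` acts on `Fᵃᵇ` by translations from both sides,
and `Fᵃᵇ · Fᵃᵇ = 0`. The three parts are the `ℋ`-classes, and their Schützenberger groups are `F`,
`Fᵃᵇ` and `1`. These have finite complete rewriting systems, and by Squier's theorem such a system
yields finite derivation type: paths to normal forms reduce every pair of parallel paths to the
resolutions of the finitely many critical pairs.

Suppose now that `M` had finite derivation type. Let `K` be the group of the matrices
`!![1, x, z; 0, t, y; 0, 0, 1]` over `ℚ`, with the central subgroup `Z` given by `t = 1` and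
`x = y = 0`. The group `F × F` acts transitively on `Fᵃᵇ`, and the stabilizer of `1` maps to `K ⧸
Z`: left translations are recorded by the upper left blocks, right translations by the lower right
ones. Lifting to `K` the translations given by the defining relations labels the derivation graph in
such a way that the labels of parallel paths between words in the class of `Fᵃᵇ` differ by elements
of `Z`. A finite homotopy base would confine these differences to a finitely generated subgroup of
`Z`. But the left translation by `[aⁿ, b]` and the right translation by `[a, b]` both fix `1` and
commute, so they give two parallel paths, whose labels differ by a commutator, namely `2⁻ⁿ - 1` in
`Z`. Then all powers of `1 / 2` would lie in a finitely generated subgroup of `ℚ`, and `1 / 2` would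
be an algebraic integer.
-/

/-! ### Reduction -/

section Reduction

variable {A : Type u} {R : Set (FreeMonoid A × FreeMonoid A)}

/-- The irreducible words of a rewriting system, to which no rule applies. -/
def IrreducibleWord (R : Set (FreeMonoid A × FreeMonoid A)) (x : FreeMonoid A) : Prop :=
  ∀ y, ¬ Rewrites R x y

theorem IrreducibleWord.eq_of_reflTransGen {x y : FreeMonoid A} (hx : IrreducibleWord R x)
    (h : Relation.ReflTransGen (Rewrites R) x y) : x = y :=
  h.cases_head.resolve_right fun ⟨z, hz, _⟩ => hx z hz

theorem isNoetherianRewriting_iff_wellFounded :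
    IsNoetherianRewriting R ↔ WellFounded fun x y => Rewrites R y x := by
  rw [wellFounded_iff_isEmpty_descending_chain, isEmpty_subtype]
  exact not_exists

theorem IsNoetherianRewriting.exists_irreducibleWord (h : IsNoetherianRewriting R)
    (x : FreeMonoid A) : ∃ z, Relation.ReflTransGen (Rewrites R) x z ∧ IrreducibleWord R z := by
  induction x using (isNoetherianRewriting_iff_wellFounded.1 h).induction with
  | _ x ih =>
    by_cases hx : IrreducibleWord R x
    · exact ⟨x, .refl, hx⟩
    · obtain ⟨y, hxy⟩ := not_forall_not.1 hx
      obtain ⟨z, hyz, hz⟩ := ih y hxy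
      exact ⟨z, .head hxy hyz, hz⟩

theorem IsConfluent.irreducibleWord_unique (h : IsConfluent R) {x y z : FreeMonoid A}
    (hxy : Relation.ReflTransGen (Rewrites R) x y) (hxz : Relation.ReflTransGen (Rewrites R) x z)
    (hy : IrreducibleWord R y) (hz : IrreducibleWord R z) : y = z := by
  obtain ⟨t, hyt, hzt⟩ := h x y z hxy hxz
  rw [hy.eq_of_reflTransGen hyt, hz.eq_of_reflTransGen hzt]

end Reduction

section Overlap

variable {A : Type u}

theorem exists_eq_mul_of_mul_eq_mul {a b c d : FreeMonoid A} (h : a * b = c * d) :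
    (∃ m, c = a * m ∧ b = m * d) ∨ ∃ m, a = c * m ∧ d = m * b :=
  List.append_eq_append_iff.1 h

/-- Two occurrences of subwords are either disjoint or, after cancelling common outer factors, span
a word that is no longer than the two subwords together. -/
theorem disjoint_or_overlap {l₁ a q₁ l₂ b q₂ : FreeMonoid A} (h : l₁ * a * q₁ = l₂ * b * q₂)
    (hle : l₁.length ≤ l₂.length) :
    (∃ m, l₂ = l₁ * a * m ∧ q₁ = m * b * q₂) ∨
      ∃ m t₁ t₂ v, l₂ = l₁ * m ∧ q₁ = t₁ * v ∧ q₂ = t₂ * v ∧ a * t₁ = m * b * t₂ ∧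
        (a * t₁).length ≤ a.length + b.length := by
  obtain ⟨m, rfl⟩ : ∃ m, l₂ = l₁ * m := by
    obtain ⟨m, hm⟩ : l₁ <+: l₂ := List.prefix_of_prefix_length_le
      ⟨a * q₁, (mul_assoc l₁ a q₁).symm.trans h⟩ ⟨b * q₂, (mul_assoc l₂ b q₂).symm⟩ hle
    exact ⟨m, hm.symm⟩
  have hm : a * q₁ = m * (b * q₂) := mul_left_cancel (a := l₁) (by simpa only [mul_assoc] using h)
  rcases exists_eq_mul_of_mul_eq_mul hm with ⟨m', rfl, rfl⟩ | ⟨m', rfl, hm'⟩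
  · exact .inl ⟨m', (mul_assoc _ _ _).symm, (mul_assoc _ _ _).symm⟩
  · right
    rcases exists_eq_mul_of_mul_eq_mul hm' with ⟨t, rfl, rfl⟩ | ⟨t, rfl, rfl⟩
    · exact ⟨m, 1, t, q₁, rfl, (one_mul q₁).symm, rfl, by rw [mul_one, mul_assoc], by simp⟩
    · refine ⟨m, t, 1, q₂, rfl, rfl, (one_mul q₂).symm, by rw [mul_one, mul_assoc], ?_⟩
      simp only [FreeMonoid.length_mul]
      omega

end Overlap

/-! ### Squier's theorem -/

namespace DerivationGraph

variable {A : Type u} {R : Set (FreeMonoid A × FreeMonoid A)} {C : Set (ParallelPair R)}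

theorem isHomotopyRelation_homotopic (C : Set (ParallelPair R)) :
    IsHomotopyRelation (fun _ _ p q => Homotopic C p q) where
  equivalence x y :=
    ⟨fun p _ hr _ => (hr.equivalence x y).refl p,
      fun h r hr hC => (hr.equivalence x y).symm (h r hr hC),
      fun h h' r hr hC => (hr.equivalence x y).trans (h r hr hC) (h' r hr hC)⟩
  interchange e₁ e₂ _ hr _ := hr.interchange e₁ e₂
  act p q w z h r hr hC := hr.act p q w z (h r hr hC)
  comp s p q t h r hr hC := hr.comp s p q t (h r hr hC)
  inv p _ hr _ := hr.inv p

namespace Homotopic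

variable {x y z : DerivationGraph R}

theorem refl (p : Quiver.Path x y) : Homotopic C p p :=
  ((isHomotopyRelation_homotopic C).equivalence x y).refl p

theorem symm {p q : Quiver.Path x y} (h : Homotopic C p q) : Homotopic C q p :=
  ((isHomotopyRelation_homotopic C).equivalence x y).symm h

theorem trans {p q r : Quiver.Path x y} (h : Homotopic C p q) (h' : Homotopic C q r) :
    Homotopic C p r :=
  ((isHomotopyRelation_homotopic C).equivalence x y).trans h h'

theorem comp_left (s : Quiver.Path x y) {p q : Quiver.Path y z} (h : Homotopic C p q) :
    Homotopic C (s.comp p) (s.comp q) :=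
  (isHomotopyRelation_homotopic C).comp s p q .nil h

theorem comp_right {p q : Quiver.Path x y} (h : Homotopic C p q) (t : Quiver.Path y z) :
    Homotopic C (p.comp t) (q.comp t) := by
  simpa only [Quiver.Path.nil_comp] using (isHomotopyRelation_homotopic C).comp .nil p q t h

theorem comp_reverse (p : Quiver.Path x y) : Homotopic C (p.comp p.reverse) .nil :=
  (isHomotopyRelation_homotopic C).inv p

theorem comp_reverse_comp (p : Quiver.Path x y) (q : Quiver.Path x z) :
    Homotopic C (p.comp (p.reverse.comp q)) q := by
  simpa only [Quiver.Path.comp_assoc, Quiver.Path.nil_comp] using (comp_reverse p).comp_right q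

theorem of_comp_right {p q : Quiver.Path x y} {n : Quiver.Path y z}
    (h : Homotopic C (p.comp n) (q.comp n)) : Homotopic C p q := by
  have cancel (s : Quiver.Path x y) : Homotopic C ((s.comp n).comp n.reverse) s := by
    simpa only [Quiver.Path.comp_assoc, Quiver.Path.comp_nil] using (comp_reverse n).comp_left s
  exact (cancel p).symm.trans ((h.comp_right _).trans (cancel q))

theorem mapPath_act (w z : DerivationGraph R) {p q : Quiver.Path x y} (h : Homotopic C p q) :
    Homotopic C ((DerivationGraph.act w z).mapPath p) ((DerivationGraph.act w z).mapPath q) :=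
  (isHomotopyRelation_homotopic C).act p q w z h

theorem of_mem {c : ParallelPair R} (hc : c ∈ C) : Homotopic C c.2.2.1 c.2.2.2 :=
  fun _ _ hC => hC c hc

end Homotopic

/-- The positive paths, all of whose edges apply a rule from left to right; they are the reduction
sequences. -/
inductive IsPositive : ∀ {x y : DerivationGraph R}, Quiver.Path x y → Prop
  | nil (x : DerivationGraph R) : IsPositive (Quiver.Path.nil : Quiver.Path x x)
  | head {x y z : DerivationGraph R} (e : x ⟶ y) (he : Edge.sign e = true) (p : Quiver.Path y z) :
      IsPositive p → IsPositive (e.toPath.comp p)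

theorem IsPositive.comp {x y z : DerivationGraph R} {p : Quiver.Path x y} {q : Quiver.Path y z}
    (hp : IsPositive p) (hq : IsPositive q) : IsPositive (p.comp q) := by
  induction hp with
  | nil => simpa only [Quiver.Path.nil_comp] using hq
  | head e he p _ ih =>
    rw [Quiver.Path.comp_assoc]
    exact .head e he _ (ih hq)

theorem IsPositive.mapPath_act {x y : DerivationGraph R} {p : Quiver.Path x y} (hp : IsPositive p)
    (w z : DerivationGraph R) : IsPositive ((DerivationGraph.act w z).mapPath p) := by
  induction hp with
  | nil => exact .nil _
  | head e he p _ ih =>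
    rw [Prefunctor.mapPath_comp]
    exact .head ((DerivationGraph.act w z).map e) he _ ih

theorem isPositive_toPath {x y : DerivationGraph R} {e : x ⟶ y} (he : Edge.sign e = true) :
    IsPositive e.toPath := by
  simpa only [Quiver.Path.comp_nil] using IsPositive.head e he .nil (.nil y)

theorem rewrites_of_edge {x y : DerivationGraph R} (e : x ⟶ y) (he : Edge.sign e = true) :
    Rewrites R x y := by
  obtain ⟨l, r, _, q, hx, hy⟩ := e
  subst he
  exact ⟨r.1, r.2, l, q, hx, hy⟩

theorem exists_edge_of_rewrites {x y : DerivationGraph R} (h : Rewrites R x y) :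
    ∃ e : x ⟶ y, Edge.sign e = true := by
  obtain ⟨r, hr, l, q, hx, hy⟩ := h
  exact ⟨Edge.mk l ⟨r, hr⟩ true q hx hy, rfl⟩

theorem exists_isPositive_iff {x y : DerivationGraph R} :
    (∃ p : Quiver.Path x y, IsPositive p) ↔ Relation.ReflTransGen (Rewrites R) x y := by
  constructor
  · rintro ⟨p, hp⟩
    induction hp with
    | nil => exact .refl
    | head e he _ _ ih => exact .head (rewrites_of_edge e he) ih
  · intro h
    induction h using Relation.ReflTransGen.head_induction_on with
    | refl => exact ⟨.nil, .nil _⟩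
    | head h _ ih =>
      obtain ⟨e, he⟩ := exists_edge_of_rewrites h
      obtain ⟨p, hp⟩ := ih
      exact ⟨_, .head e he p hp⟩

theorem IsPositive.reflTransGen {x y : DerivationGraph R} {p : Quiver.Path x y}
    (hp : IsPositive p) : Relation.ReflTransGen (Rewrites R) x y :=
  exists_isPositive_iff.1 ⟨p, hp⟩

/-- The peak `x ← w → y` formed by the edges `e` and `f` closes up along positive paths, by a
diagram that commutes modulo the homotopy relation generated by `C`. -/
def Closes (C : Set (ParallelPair R)) {w x y : DerivationGraph R} (e : w ⟶ x) (f : w ⟶ y) : Prop :=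
  ∃ (z : DerivationGraph R) (p : Quiver.Path x z) (q : Quiver.Path y z),
    IsPositive p ∧ IsPositive q ∧ Homotopic C (e.toPath.comp p) (f.toPath.comp q)

/-- All peaks of positive edges that start at `w` close up. -/
def ClosesPeaksAt (C : Set (ParallelPair R)) (w : DerivationGraph R) : Prop :=
  ∀ ⦃x y : DerivationGraph R⦄ (e : w ⟶ x) (f : w ⟶ y), Edge.sign e = true → Edge.sign f = true →
    Closes C e f

theorem Closes.symm {w x y : DerivationGraph R} {e : w ⟶ x} {f : w ⟶ y} (h : Closes C e f) :
    Closes C f e := by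
  obtain ⟨z, p, q, hp, hq, h⟩ := h
  exact ⟨z, q, p, hq, hp, h.symm⟩

theorem Closes.act {w x y : DerivationGraph R} {e : w ⟶ x} {f : w ⟶ y} (h : Closes C e f)
    (u v : DerivationGraph R) :
    Closes C ((DerivationGraph.act u v).map e) ((DerivationGraph.act u v).map f) := by
  obtain ⟨z, p, q, hp, hq, h⟩ := h
  exact ⟨_, _, _, hp.mapPath_act u v, hq.mapPath_act u v, by
    simpa only [Prefunctor.mapPath_comp, Prefunctor.mapPath_toPath] using h.mapPath_act u v⟩

theorem closes_edgeRight_edgeLeft {x₁ y₁ x₂ y₂ : DerivationGraph R} (e : x₁ ⟶ y₁) (f : x₂ ⟶ y₂)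
    (he : Edge.sign e = true) (hf : Edge.sign f = true) :
    Closes C (edgeRight e x₂) (edgeLeft x₁ f) :=
  ⟨y₁ * y₂, (edgeLeft y₁ f).toPath, (edgeRight e y₂).toPath, isPositive_toPath hf,
    isPositive_toPath he, (isHomotopyRelation_homotopic C).interchange e f⟩

/-- The edge `e` is the translate `u · e₀ · v`. The endpoints of `e` are only propositionally equal
to those of `u · e₀ · v`, so that the two edges have different types. -/
structure IsTranslate (u v : DerivationGraph R) {w₀ x₀ w x : DerivationGraph R} (e₀ : w₀ ⟶ x₀)
    (e : w ⟶ x) : Prop where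
  left_eq : Edge.left e = u * Edge.left e₀
  rule_eq : Edge.rule e = Edge.rule e₀
  sign_eq : Edge.sign e = Edge.sign e₀
  right_eq : Edge.right e = Edge.right e₀ * v

namespace IsTranslate

variable {u v w₀ x₀ w x : DerivationGraph R} {e₀ : w₀ ⟶ x₀}

theorem initial_eq {e : w ⟶ x} (h : IsTranslate u v e₀ e) : w = u * w₀ * v := by
  rw [Edge.initial_eq e, Edge.initial_eq e₀, h.left_eq, h.rule_eq, h.sign_eq, h.right_eq]
  simp only [mul_assoc]

theorem terminal_eq {e : w ⟶ x} (h : IsTranslate u v e₀ e) : x = u * x₀ * v := by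
  rw [Edge.terminal_eq e, Edge.terminal_eq e₀, h.left_eq, h.rule_eq, h.sign_eq, h.right_eq]
  simp only [mul_assoc]

theorem eq_act_map {e : u * w₀ * v ⟶ u * x₀ * v} (h : IsTranslate u v e₀ e) :
    e = (DerivationGraph.act u v).map e₀ :=
  Edge.ext h.left_eq h.rule_eq h.sign_eq h.right_eq

end IsTranslate

theorem Closes.of_isTranslate {u v w x y w₀ x₀ y₀ : DerivationGraph R} {e : w ⟶ x} {f : w ⟶ y}
    {e₀ : w₀ ⟶ x₀} {f₀ : w₀ ⟶ y₀} (h : Closes C e₀ f₀) (he : IsTranslate u v e₀ e)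
    (hf : IsTranslate u v f₀ f) : Closes C e f := by
  obtain rfl := he.initial_eq
  obtain rfl := he.terminal_eq
  obtain rfl := hf.terminal_eq
  rw [he.eq_act_map, hf.eq_act_map]
  exact h.act u v

theorem homotopic_of_isPositive (hR : IsCompleteRewriting R) (hC : ∀ w, ClosesPeaksAt C w)
    {x z : DerivationGraph R} (hz : IrreducibleWord R z) {p q : Quiver.Path x z}
    (hp : IsPositive p) (hq : IsPositive q) : Homotopic C p q := by
  have hwf : WellFounded fun x y : DerivationGraph R => Rewrites R y x :=
    isNoetherianRewriting_iff_wellFounded.1 hR.1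
  induction x using hwf.induction with
  | _ x ih =>
    cases hp with
    | nil =>
      cases hq with
      | nil => exact .refl _
      | head f hf q hq => exact (hz _ (rewrites_of_edge f hf)).elim
    | head e he p hp =>
      cases hq with
      | nil => exact (hz _ (rewrites_of_edge e he)).elim
      | head f hf q hq =>
        obtain ⟨t, p', q', hp', hq', h⟩ := hC x e f he hf
        obtain ⟨z', htz', hz'⟩ := hR.1.exists_irreducibleWord t
        obtain rfl : z = z' := hR.2.irreducibleWord_unique hp.reflTransGen
          (hp'.reflTransGen.trans htz') hz hz'
        obtain ⟨n, hn⟩ := exists_isPositive_iff.2 htz'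
        have hpn := ih _ (rewrites_of_edge e he) hp (hp'.comp hn)
        have hqn := ih _ (rewrites_of_edge f hf) hq (hq'.comp hn)
        refine (hpn.comp_left _).trans (.trans ?_ (hqn.comp_left _).symm)
        rw [← Quiver.Path.comp_assoc, ← Quiver.Path.comp_assoc]
        exact h.comp_right n

/-- Read from its end, the path is straightened edge by edge: a negative edge is cancelled against
a positive path through its source, which exists because irreducible descendants are unique. -/
theorem exists_isPositive_homotopic_comp (hR : IsCompleteRewriting R)
    (hC : ∀ w, ClosesPeaksAt C w) {x y z : DerivationGraph R} (hz : IrreducibleWord R z)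
    (p : Quiver.Path x y) {n : Quiver.Path y z} (hn : IsPositive n) :
    ∃ m : Quiver.Path x z, IsPositive m ∧ Homotopic C (p.comp n) m := by
  induction p with
  | nil => exact ⟨n, hn, by simpa only [Quiver.Path.nil_comp] using Homotopic.refl n⟩
  | @cons y' y p e ih =>
    rw [← Quiver.Path.comp_toPath_eq_cons, Quiver.Path.comp_assoc]
    cases he : Edge.sign e with
    | true => exact ih (.head e he n hn)
    | false =>
      have he' : Edge.sign (Quiver.reverse e) = true := congrArg (!·) he
      obtain ⟨z', hyz', hz'⟩ := hR.1.exists_irreducibleWord y'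
      obtain ⟨n', hn'⟩ := exists_isPositive_iff.2 hyz'
      have hen' := IsPositive.head (Quiver.reverse e) he' n' hn'
      obtain rfl : z = z' :=
        hR.2.irreducibleWord_unique hn.reflTransGen hen'.reflTransGen hz hz'
      have hcancel : Homotopic C (e.toPath.comp n) n' := by
        refine ((homotopic_of_isPositive hR hC hz hn hen').comp_left _).trans ?_
        rw [← Quiver.Path.reverse_toPath]
        exact Homotopic.comp_reverse_comp e.toPath n'
      obtain ⟨m, hm, hpm⟩ := ih hn'
      exact ⟨m, hm, (hcancel.comp_left p).trans hpm⟩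

theorem isHomotopyBase_of_closesPeaksAt (hR : IsCompleteRewriting R)
    (hC : ∀ w, ClosesPeaksAt C w) : IsHomotopyBase C := by
  intro x y p q
  obtain ⟨z, hyz, hz⟩ := hR.1.exists_irreducibleWord y
  obtain ⟨n, hn⟩ := exists_isPositive_iff.2 hyz
  obtain ⟨m, hm, hpm⟩ := exists_isPositive_homotopic_comp hR hC hz p hn
  obtain ⟨m', hm', hqm'⟩ := exists_isPositive_homotopic_comp hR hC hz q hn
  exact (hpm.trans ((homotopic_of_isPositive hR hC hz hm hm').trans hqm'.symm)).of_comp_right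

/-- Disjoint peaks close up by the interchange relation, and overlapping ones are translates of
peaks at short words. -/
theorem closesPeaksAt_of_length_le {N : ℕ}
    (hN : ∀ r ∈ R, ∀ s ∈ R, r.1.length + s.1.length ≤ N)
    (hC : ∀ w : FreeMonoid A, w.length ≤ N → ClosesPeaksAt C w) (w : DerivationGraph R) :
    ClosesPeaksAt C w := by
  intro x y e f he hf
  wlog hle : FreeMonoid.length (Edge.left e) ≤ FreeMonoid.length (Edge.left f) generalizing x y
  · exact (this f e hf he (le_of_not_ge hle)).symm
  obtain ⟨l₁, r, _, q₁, hwr, rfl⟩ := e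
  obtain ⟨l₂, s, _, q₂, hws, rfl⟩ := f
  subst he hf
  rcases disjoint_or_overlap (hwr.symm.trans hws) hle with
    ⟨(m : DerivationGraph R), hl₂, hq₁⟩ | ⟨m, t₁, t₂, v, hl₂, hq₁, hq₂, hoverlap, hlen⟩
  · have hclose := closes_edgeRight_edgeLeft (C := C)
      (Edge.mk 1 r true m (one_mul _).symm rfl : side r true * m ⟶ _)
      (Edge.mk 1 s true 1 (by rw [one_mul, mul_one]) rfl : side s true ⟶ _) rfl rfl
    refine hclose.of_isTranslate (u := l₁) (v := q₂) ⟨(mul_one l₁).symm, rfl, rfl, hq₁⟩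
      ⟨?_, rfl, rfl, (one_mul q₂).symm⟩
    exact hl₂.trans ((mul_assoc _ _ _).trans (congrArg (l₁ * ·) (mul_one _).symm))
  · have hclose := hC _ (hlen.trans (hN _ r.2 _ s.2))
      (Edge.mk 1 r true t₁ (one_mul _).symm rfl) (Edge.mk m s true t₂ hoverlap rfl) rfl rfl
    exact hclose.of_isTranslate (u := l₁) (v := v) ⟨(mul_one l₁).symm, rfl, rfl, hq₁⟩
      ⟨hl₂, rfl, rfl, hq₂⟩

theorem length_initial {x y : DerivationGraph R} (e : x ⟶ y) :
    FreeMonoid.length x = FreeMonoid.length (Edge.left e) +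
      FreeMonoid.length (side (Edge.rule e) (Edge.sign e)) + FreeMonoid.length (Edge.right e) := by
  have h := congrArg FreeMonoid.length (Edge.initial_eq e)
  exact h.trans ((FreeMonoid.length_mul _ _).trans (congrArg (· + _) (FreeMonoid.length_mul _ _)))

theorem finite_sigma_edge [Finite A] (hR : R.Finite) (w : DerivationGraph R) :
    Finite (Σ x, w ⟶ x) := by
  have := hR.to_subtype
  let words := {l : FreeMonoid A | l.length ≤ FreeMonoid.length w}
  have : Finite words := List.finite_length_le A _
  have hleft {x : DerivationGraph R} (e : w ⟶ x) : Edge.left e ∈ words :=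
    ((Nat.le_add_right _ _).trans (Nat.le_add_right _ _)).trans (length_initial e).ge
  have hright {x : DerivationGraph R} (e : w ⟶ x) : Edge.right e ∈ words :=
    (Nat.le_add_left _ _).trans (length_initial e).ge
  let position (e : Σ x, w ⟶ x) : words × R × Bool × words :=
    (⟨Edge.left e.2, hleft e.2⟩, Edge.rule e.2, Edge.sign e.2, ⟨Edge.right e.2, hright e.2⟩)
  refine Finite.of_injective position ?_
  rintro ⟨x, l, r, ε, q, h₁, rfl⟩ ⟨y, l', r', ε', q', h₂, rfl⟩ h
  obtain ⟨hl, hr, hε, hq⟩ := by simpa only [Prod.ext_iff] using h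
  obtain rfl := congrArg Subtype.val hl
  obtain rfl := congrArg Subtype.val hq
  subst hr hε
  rfl

theorem exists_parallelPair_closes (hR : IsConfluent R) {w x y : DerivationGraph R} {e : w ⟶ x}
    {f : w ⟶ y} (he : Edge.sign e = true) (hf : Edge.sign f = true) :
    ∃ c : ParallelPair R, ∀ C, c ∈ C → Closes C e f := by
  obtain ⟨z, hxz, hyz⟩ := hR w x y (.single (rewrites_of_edge e he))
    (.single (rewrites_of_edge f hf))
  obtain ⟨p, hp⟩ := exists_isPositive_iff.2 hxz
  obtain ⟨q, hq⟩ := exists_isPositive_iff.2 hyz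
  exact ⟨⟨w, z, e.toPath.comp p, f.toPath.comp q⟩, fun C hC => ⟨z, p, q, hp, hq, .of_mem hC⟩⟩

theorem exists_finite_closesPeaksAt [Finite A] (hfin : R.Finite) (hR : IsConfluent R) (N : ℕ) :
    ∃ C : Set (ParallelPair R), C.Finite ∧
      ∀ w : FreeMonoid A, w.length ≤ N → ClosesPeaksAt C w := by
  let Peak := Σ w : {w : DerivationGraph R | FreeMonoid.length w ≤ N},
    {p : (Σ x, w.1 ⟶ x) × (Σ y, w.1 ⟶ y) // Edge.sign p.1.2 = true ∧ Edge.sign p.2.2 = true}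
  have hclose (d : Peak) : ∃ c : ParallelPair R, ∀ C, c ∈ C → Closes C d.2.1.1.2 d.2.1.2.2 :=
    exists_parallelPair_closes hR d.2.2.1 d.2.2.2
  choose pair hpair using hclose
  have hfinWords : Finite {w : DerivationGraph R | FreeMonoid.length w ≤ N} :=
    List.finite_length_le A N
  have hfinEdges (w : DerivationGraph R) : Finite (Σ x, w ⟶ x) := finite_sigma_edge hfin w
  have hfinPeaks : Finite Peak := inferInstanceAs (Finite (Σ _, _))
  exact ⟨Set.range pair, Set.finite_range pair, fun w hw x y e f he hf =>
    hpair ⟨⟨w, hw⟩, (⟨x, e⟩, ⟨y, f⟩), he, hf⟩ _ (Set.mem_range_self _)⟩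

end DerivationGraph

theorem presentationFDT_of_isCompleteRewriting {A : Type u} [Finite A]
    {R : Set (FreeMonoid A × FreeMonoid A)} (hfin : R.Finite) (hR : IsCompleteRewriting R) :
    PresentationFDT R := by
  obtain ⟨N, hN⟩ := (hfin.image fun r => r.1.length).bddAbove
  have hN' (r) (hr : r ∈ R) : r.1.length ≤ N := hN ⟨r, hr, rfl⟩
  obtain ⟨C, hC, hclose⟩ := DerivationGraph.exists_finite_closesPeaksAt hfin hR.2 (N + N)
  exact ⟨C, hC, DerivationGraph.isHomotopyBase_of_closesPeaksAt hR
    (DerivationGraph.closesPeaksAt_of_length_le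
      (fun r hr s hs => add_le_add (hN' r hr) (hN' s hs)) hclose)⟩

theorem HasFiniteCompleteRewriting.hasFDT {S : Type v} [Monoid S]
    (h : HasFiniteCompleteRewriting S) : HasFDT S := by
  obtain ⟨A, R, hA, hfin, hR, e⟩ := h
  exact ⟨A, R, hA, hfin, e, presentationFDT_of_isCompleteRewriting hfin hR⟩

/-! ### Complete rewriting systems from normal forms -/

section NormalForms

variable {A : Type u} {R : Set (FreeMonoid A × FreeMonoid A)}

theorem Rewrites.of_mem {x y : FreeMonoid A} (h : (x, y) ∈ R) : Rewrites R x y :=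
  ⟨(x, y), h, 1, 1, by simp, by simp⟩

theorem Rewrites.mul_left {x y : FreeMonoid A} (h : Rewrites R x y) (w : FreeMonoid A) :
    Rewrites R (w * x) (w * y) := by
  obtain ⟨r, hr, w₁, w₂, rfl, rfl⟩ := h
  exact ⟨r, hr, w * w₁, w₂, by simp only [mul_assoc], by simp only [mul_assoc]⟩

theorem Rewrites.mul_right {x y : FreeMonoid A} (h : Rewrites R x y) (w : FreeMonoid A) :
    Rewrites R (x * w) (y * w) := by
  obtain ⟨r, hr, w₁, w₂, rfl, rfl⟩ := h
  exact ⟨r, hr, w₁, w₂ * w, by simp only [mul_assoc], by simp only [mul_assoc]⟩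

theorem Rewrites.map {B : Type v} {S : Set (FreeMonoid B × FreeMonoid B)}
    (f : FreeMonoid A →* FreeMonoid B) (hf : ∀ r ∈ R, (f r.1, f r.2) ∈ S) {x y : FreeMonoid A}
    (h : Rewrites R x y) : Rewrites S (f x) (f y) := by
  obtain ⟨r, hr, w₁, w₂, rfl, rfl⟩ := h
  exact ⟨_, hf r hr, f w₁, f w₂, by simp only [map_mul], by simp only [map_mul]⟩

theorem reflTransGen_rewrites_mul {x x' y y' : FreeMonoid A}
    (hx : Relation.ReflTransGen (Rewrites R) x x') (hy : Relation.ReflTransGen (Rewrites R) y y') :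
    Relation.ReflTransGen (Rewrites R) (x * y) (x' * y') :=
  (hx.lift (· * y) fun _ _ h => h.mul_right y).trans (hy.lift (x' * ·) fun _ _ h => h.mul_left x')

theorem map_eq_of_reflTransGen {S : Type v} [Monoid S] {π : FreeMonoid A →* S}
    (hπ : ∀ r ∈ R, π r.1 = π r.2) {x y : FreeMonoid A}
    (h : Relation.ReflTransGen (Rewrites R) x y) : π x = π y := by
  induction h with
  | refl => rfl
  | tail _ h ih =>
    obtain ⟨r, hr, w₁, w₂, rfl, rfl⟩ := h
    simp only [ih, map_mul, hπ r hr]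

/-- The class of a word in the monoid presented by `R`. -/
abbrev wordClass (R : Set (FreeMonoid A × FreeMonoid A)) : FreeMonoid A →* MonoidOf R :=
  PresentedMonoid.mk _

theorem wordClass_eq_of_mem {r : FreeMonoid A × FreeMonoid A} (hr : r ∈ R) :
    wordClass R r.1 = wordClass R r.2 :=
  PresentedMonoid.mk_eq_mk_of_rel hr

theorem isNoetherianRewriting_of_wellFounded {β : Type v} {lt : β → β → Prop} (hlt : WellFounded lt)
    (μ : FreeMonoid A → β) (h : ∀ x y, Rewrites R x y → lt (μ y) (μ x)) :
    IsNoetherianRewriting R :=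
  isNoetherianRewriting_iff_wellFounded.2
    (Subrelation.wf (fun {y x} hxy => h x y hxy) (InvImage.wf μ hlt))

theorem IsConfluent.joinable_of_wordClass_eq (hR : IsConfluent R) {x y : FreeMonoid A}
    (h : wordClass R x = wordClass R y) :
    ∃ z, Relation.ReflTransGen (Rewrites R) x z ∧ Relation.ReflTransGen (Rewrites R) y z := by
  let joinable : Con (FreeMonoid A) :=
    { r x y := ∃ z, Relation.ReflTransGen (Rewrites R) x z ∧ Relation.ReflTransGen (Rewrites R) y z
      iseqv :=
        { refl x := ⟨x, .refl, .refl⟩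
          symm := fun ⟨z, hx, hy⟩ => ⟨z, hy, hx⟩
          trans := fun ⟨z, hx, hy⟩ ⟨z', hy', hw⟩ =>
            let ⟨t, hzt, hzt'⟩ := hR _ z z' hy hy'
            ⟨t, hx.trans hzt, hw.trans hzt'⟩ }
      mul' := fun ⟨z, hx, hy⟩ ⟨z', hx', hy'⟩ =>
        ⟨z * z', reflTransGen_rewrites_mul hx hx', reflTransGen_rewrites_mul hy hy'⟩ }
  have hle : conGen (fun x y => (x, y) ∈ R) ≤ joinable :=
    Con.conGen_le.2 fun x y hxy => ⟨y, .single (.of_mem hxy), .refl⟩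
  exact hle ((Con.eq _).1 h)

theorem IsCompleteRewriting.exists_normalForm (hR : IsCompleteRewriting R) :
    ∃ N : MonoidOf R → FreeMonoid A,
      ∀ w, Relation.ReflTransGen (Rewrites R) w (N (wordClass R w)) := by
  choose nf hnf hirr using hR.1.exists_irreducibleWord
  choose word hword using PresentedMonoid.surjective_mk (rels := fun x y => (x, y) ∈ R)
  refine ⟨fun s => nf (word s), fun w => ?_⟩
  obtain ⟨z, hwz, hz⟩ := hR.2.joinable_of_wordClass_eq (hword (wordClass R w)).symm
  have h : nf (word (wordClass R w)) = nf z :=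
    hR.2.irreducibleWord_unique (hnf _) (hz.trans (hnf z)) (hirr _) (hirr z)
  simpa only [h] using hwz.trans (hnf z)

theorem hasFiniteCompleteRewriting_of_normalForm {S : Type v} [Monoid S] {A : Type} [Finite A]
    {R : Set (FreeMonoid A × FreeMonoid A)} (hfin : R.Finite) (hR : IsNoetherianRewriting R)
    {π : FreeMonoid A →* S} (hπ : Function.Surjective π) (hrel : ∀ r ∈ R, π r.1 = π r.2)
    (N : S → FreeMonoid A) (hN : ∀ w, Relation.ReflTransGen (Rewrites R) w (N (π w))) :
    HasFiniteCompleteRewriting S := by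
  refine ⟨A, R, inferInstance, hfin, ⟨hR, fun w x y hx hy => ⟨N (π w), ?_, ?_⟩⟩, ⟨?_⟩⟩
  · rw [map_eq_of_reflTransGen hrel hx]
    exact hN x
  · rw [map_eq_of_reflTransGen hrel hy]
    exact hN y
  · let φ : MonoidOf R →* S := Con.lift _ π (Con.conGen_le.2 fun x y h => hrel (x, y) h)
    refine MulEquiv.ofBijective φ ⟨fun x y h => ?_, fun s => ?_⟩
    · obtain ⟨x, rfl⟩ := PresentedMonoid.surjective_mk x
      obtain ⟨y, rfl⟩ := PresentedMonoid.surjective_mk y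
      have hxy : π x = π y := h
      have hclass (w) : wordClass R w = wordClass R (N (π w)) :=
        map_eq_of_reflTransGen (fun _ => wordClass_eq_of_mem) (hN w)
      exact (hclass x).trans ((congrArg (fun s => wordClass R (N s)) hxy).trans (hclass y).symm)
    · obtain ⟨w, rfl⟩ := hπ s
      exact ⟨wordClass R w, rfl⟩

theorem HasFiniteCompleteRewriting.of_mulEquiv {S : Type u} {T : Type v} [Monoid S] [Monoid T]
    (h : HasFiniteCompleteRewriting S) (e : S ≃* T) : HasFiniteCompleteRewriting T := by
  obtain ⟨A, R, hA, hfin, hR, ⟨f⟩⟩ := h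
  exact ⟨A, R, hA, hfin, hR, ⟨f.trans e⟩⟩

end NormalForms

/-! ### Free groups -/

/-- The free reductions `x x⁻¹ → 1` on signed letters. -/
def freeReductions (α : Type u) : Set (FreeMonoid (α × Bool) × FreeMonoid (α × Bool)) :=
  Set.range fun p : α × Bool => (FreeMonoid.of p * FreeMonoid.of (p.1, !p.2), 1)

theorem rewrites_freeReductions_of_step {α : Type u} {x y : List (α × Bool)}
    (h : FreeGroup.Red.Step x y) :
    Rewrites (freeReductions α) (FreeMonoid.ofList x) (FreeMonoid.ofList y) := by
  obtain @⟨L₁, L₂, x, b⟩ := h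
  refine ⟨_, ⟨(x, b), rfl⟩, FreeMonoid.ofList L₁, FreeMonoid.ofList L₂, ?_, ?_⟩
  · exact FreeMonoid.toList.injective (List.append_assoc L₁ [(x, b), (x, !b)] L₂).symm
  · rw [mul_one, FreeMonoid.ofList_append]

theorem isNoetherianRewriting_freeReductions (α : Type u) :
    IsNoetherianRewriting (freeReductions α) := by
  refine isNoetherianRewriting_of_wellFounded wellFounded_lt FreeMonoid.length ?_
  rintro x y ⟨_, ⟨p, rfl⟩, w₁, w₂, rfl, rfl⟩
  simp only [FreeMonoid.length_mul, FreeMonoid.length_of, FreeMonoid.length_one]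
  omega

theorem hasFiniteCompleteRewriting_freeGroup (α : Type) [Finite α] :
    HasFiniteCompleteRewriting (FreeGroup α) := by
  classical
  let π : FreeMonoid (α × Bool) →* FreeGroup α :=
    { toFun := fun w => FreeGroup.mk w.toList
      map_one' := rfl
      map_mul' := fun x y => by rw [FreeMonoid.toList_mul, FreeGroup.mul_mk] }
  refine hasFiniteCompleteRewriting_of_normalForm (π := π) (Set.finite_range _)
    (isNoetherianRewriting_freeReductions α) ?_ ?_ (fun g => FreeMonoid.ofList g.toWord)
    fun w => ?_
  · rintro ⟨L⟩
    exact ⟨FreeMonoid.ofList L, rfl⟩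
  · rintro _ ⟨p, rfl⟩
    exact Quot.sound (FreeGroup.Red.Step.not (L₁ := []) (L₂ := []) (x := p.1) (b := p.2))
  · have hred : FreeGroup.Red w.toList (FreeGroup.mk w.toList).toWord := by
      rw [FreeGroup.toWord_mk]
      exact FreeGroup.reduce.red
    exact Relation.ReflTransGen.lift (p := Rewrites _) FreeMonoid.ofList
      (fun _ _ => rewrites_freeReductions_of_step) _ _ hred

/-! ### Direct products -/

section Prod

variable {A : Type u} {B : Type v}

/-- The rules `b a → a b` that sort the letters of a disjoint union of two alphabets. -/
def sortingRules (A : Type u) (B : Type v) : Set (FreeMonoid (A ⊕ B) × FreeMonoid (A ⊕ B)) :=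
  Set.range fun p : A × B =>
    (FreeMonoid.of (.inr p.2) * FreeMonoid.of (.inl p.1),
      FreeMonoid.of (.inl p.1) * FreeMonoid.of (.inr p.2))

/-- The rewriting system for a direct product: the rules of both factors and the sorting rules. -/
def prodRules (R : Set (FreeMonoid A × FreeMonoid A)) (S : Set (FreeMonoid B × FreeMonoid B)) :
    Set (FreeMonoid (A ⊕ B) × FreeMonoid (A ⊕ B)) :=
  Prod.map (FreeMonoid.map .inl) (FreeMonoid.map .inl) '' R ∪
    Prod.map (FreeMonoid.map .inr) (FreeMonoid.map .inr) '' S ∪ sortingRules A B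

/-- The subword of the letters from the first alphabet. -/
def lefts : FreeMonoid (A ⊕ B) →* FreeMonoid A :=
  FreeMonoid.lift (Sum.elim FreeMonoid.of fun _ => 1)

/-- The subword of the letters from the second alphabet. -/
def rights : FreeMonoid (A ⊕ B) →* FreeMonoid B :=
  FreeMonoid.lift (Sum.elim (fun _ => 1) FreeMonoid.of)

theorem lefts_of_inl (a : A) : lefts (B := B) (FreeMonoid.of (.inl a)) = FreeMonoid.of a := rfl

theorem lefts_of_inr (b : B) : lefts (A := A) (FreeMonoid.of (.inr b)) = 1 := rfl

theorem rights_of_inl (a : A) : rights (B := B) (FreeMonoid.of (.inl a)) = 1 := rfl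

theorem rights_of_inr (b : B) : rights (A := A) (FreeMonoid.of (.inr b)) = FreeMonoid.of b := rfl

theorem lefts_map_inl (w : FreeMonoid A) : lefts (B := B) (FreeMonoid.map .inl w) = w :=
  DFunLike.congr_fun (FreeMonoid.hom_eq fun _ => rfl :
    lefts.comp (FreeMonoid.map .inl) = MonoidHom.id (FreeMonoid A)) w

theorem lefts_map_inr (w : FreeMonoid B) : lefts (A := A) (FreeMonoid.map .inr w) = 1 :=
  DFunLike.congr_fun (FreeMonoid.hom_eq fun _ => rfl : lefts.comp (FreeMonoid.map .inr) = 1) w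

theorem rights_map_inl (w : FreeMonoid A) : rights (B := B) (FreeMonoid.map .inl w) = 1 :=
  DFunLike.congr_fun (FreeMonoid.hom_eq fun _ => rfl : rights.comp (FreeMonoid.map .inl) = 1) w

theorem rights_map_inr (w : FreeMonoid B) : rights (A := A) (FreeMonoid.map .inr w) = w :=
  DFunLike.congr_fun (FreeMonoid.hom_eq fun _ => rfl :
    rights.comp (FreeMonoid.map .inr) = MonoidHom.id (FreeMonoid B)) w

theorem reflTransGen_of_inr_mul_map_inl (b : B) (w : FreeMonoid A) :
    Relation.ReflTransGen (Rewrites (sortingRules A B))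
      (FreeMonoid.of (.inr b) * FreeMonoid.map .inl w)
      (FreeMonoid.map .inl w * FreeMonoid.of (.inr b)) := by
  induction w using FreeMonoid.inductionOn' with
  | one => exact .refl
  | of_mul a w ih =>
    have hswap : Rewrites (sortingRules A B) (FreeMonoid.of (.inr b) * FreeMonoid.of (.inl a))
      (FreeMonoid.of (.inl a) * FreeMonoid.of (.inr b)) := .of_mem ⟨(a, b), rfl⟩
    have hfirst := Relation.ReflTransGen.single (hswap.mul_right (FreeMonoid.map .inl w))
    have hrest := reflTransGen_rewrites_mul (x := FreeMonoid.of (.inl a)) .refl ih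
    simp only [map_mul, FreeMonoid.map_of, mul_assoc] at hfirst hrest ⊢
    exact hfirst.trans hrest

theorem reflTransGen_sortingRules (w : FreeMonoid (A ⊕ B)) :
    Relation.ReflTransGen (Rewrites (sortingRules A B)) w
      (FreeMonoid.map .inl (lefts w) * FreeMonoid.map .inr (rights w)) := by
  induction w using FreeMonoid.inductionOn' with
  | one => exact .refl
  | of_mul c w ih =>
    have htail := reflTransGen_rewrites_mul (x := FreeMonoid.of c) .refl ih
    rcases c with a | b
    · simpa only [map_mul, lefts_of_inl, rights_of_inl, FreeMonoid.map_of, one_mul, mul_assoc]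
        using htail
    · have hswap := reflTransGen_rewrites_mul (reflTransGen_of_inr_mul_map_inl b (lefts w))
        (.refl (a := FreeMonoid.map .inr (rights w)))
      simp only [map_mul, lefts_of_inr, rights_of_inr, FreeMonoid.map_of, one_mul, mul_assoc]
        at htail hswap ⊢
      exact htail.trans hswap

variable {R : Set (FreeMonoid A × FreeMonoid A)} {S : Set (FreeMonoid B × FreeMonoid B)}

theorem reflTransGen_prodRules {w : FreeMonoid (A ⊕ B)} {x : FreeMonoid A} {y : FreeMonoid B}
    (hx : Relation.ReflTransGen (Rewrites R) (lefts w) x)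
    (hy : Relation.ReflTransGen (Rewrites S) (rights w) y) :
    Relation.ReflTransGen (Rewrites (prodRules R S)) w
      (FreeMonoid.map .inl x * FreeMonoid.map .inr y) := by
  have hsort : Relation.ReflTransGen (Rewrites (prodRules R S)) w
      (FreeMonoid.map .inl (lefts w) * FreeMonoid.map .inr (rights w)) :=
    Relation.ReflTransGen.mono (fun _ _ ⟨r, hr, h⟩ => ⟨r, .inr hr, h⟩) _ _
      (reflTransGen_sortingRules w)
  exact hsort.trans <| reflTransGen_rewrites_mul
    (hx.lift _ fun _ _ h => h.map _ fun r hr => .inl (.inl ⟨r, hr, rfl⟩))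
    (hy.lift _ fun _ _ h => h.map _ fun r hr => .inl (.inr ⟨r, hr, rfl⟩))

/-- A weight that drops when a letter of the first alphabet moves to the left: a word acts on `ℕ`,
the letters of the first alphabet by `n ↦ n + 1` and those of the second by `n ↦ 2 n + 1`. -/
def sortingWeight : FreeMonoid (A ⊕ B) →* Function.End ℕ :=
  FreeMonoid.lift (Sum.elim (fun _ n => n + 1) fun _ n => 2 * n + 1)

theorem sortingWeight_strictMono (w : FreeMonoid (A ⊕ B)) : StrictMono (sortingWeight w) := by
  induction w using FreeMonoid.inductionOn' with
  | one => exact strictMono_id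
  | of_mul c w ih =>
    rw [map_mul]
    refine StrictMono.comp (g := sortingWeight (FreeMonoid.of c)) (fun m n hmn => ?_) ih
    rcases c with _ | _
    · exact Nat.add_lt_add_right hmn 1
    · exact Nat.add_lt_add_right (Nat.mul_lt_mul_of_pos_left hmn two_pos) 1

theorem rewrites_sortingRules_weight_lt {x y : FreeMonoid (A ⊕ B)}
    (h : Rewrites (sortingRules A B) x y) : sortingWeight y 0 < sortingWeight x 0 := by
  obtain ⟨_, ⟨_, rfl⟩, w₁, w₂, rfl, rfl⟩ := h
  simp only [map_mul]
  refine sortingWeight_strictMono w₁ ?_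
  change 2 * sortingWeight w₂ 0 + 1 + 1 < 2 * (sortingWeight w₂ 0 + 1) + 1
  omega

theorem isNoetherianRewriting_prodRules (hR : IsNoetherianRewriting R)
    (hS : IsNoetherianRewriting S) : IsNoetherianRewriting (prodRules R S) := by
  rw [isNoetherianRewriting_iff_wellFounded] at hR hS
  refine isNoetherianRewriting_of_wellFounded (hR.prod_lex (hS.prod_lex wellFounded_lt))
    (fun w => (lefts w, rights w, sortingWeight w 0)) fun x y hxy => ?_
  obtain ⟨r, (⟨r, hr, rfl⟩ | ⟨r, hr, rfl⟩) | hr, w₁, w₂, rfl, rfl⟩ := hxy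
  · refine Prod.Lex.left _ _ ⟨r, hr, lefts w₁, lefts w₂, ?_, ?_⟩ <;>
      simp only [map_mul, Prod.map_fst, Prod.map_snd, lefts_map_inl]
  · simp only [map_mul, Prod.map_fst, Prod.map_snd, lefts_map_inr]
    refine Prod.Lex.right _ (Prod.Lex.left _ _ ⟨r, hr, rights w₁, rights w₂, ?_, ?_⟩) <;>
      simp only [rights_map_inr]
  · have hlt := rewrites_sortingRules_weight_lt ⟨r, hr, w₁, w₂, rfl, rfl⟩
    obtain ⟨_, rfl⟩ := hr
    simp only [map_mul lefts, map_mul rights, lefts_of_inl, lefts_of_inr, rights_of_inl,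
      rights_of_inr, one_mul, mul_one]
    exact Prod.Lex.right _ (Prod.Lex.right _ hlt)

end Prod

theorem HasFiniteCompleteRewriting.prod {S : Type u} {T : Type v} [Monoid S] [Monoid T]
    (hS : HasFiniteCompleteRewriting S) (hT : HasFiniteCompleteRewriting T) :
    HasFiniteCompleteRewriting (S × T) := by
  obtain ⟨A, R₁, hA, hfin₁, hR₁, ⟨f⟩⟩ := hS
  obtain ⟨B, R₂, hB, hfin₂, hR₂, ⟨g⟩⟩ := hT
  obtain ⟨N₁, hN₁⟩ := hR₁.exists_normalForm
  obtain ⟨N₂, hN₂⟩ := hR₂.exists_normalForm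
  let π : FreeMonoid (A ⊕ B) →* MonoidOf R₁ × MonoidOf R₂ :=
    ((wordClass R₁).comp lefts).prod ((wordClass R₂).comp rights)
  have hπ (x : FreeMonoid A) (y : FreeMonoid B) :
      π (FreeMonoid.map .inl x * FreeMonoid.map .inr y) = (wordClass R₁ x, wordClass R₂ y) := by
    simp only [π, MonoidHom.prod_apply, MonoidHom.comp_apply, map_mul, lefts_map_inl,
      lefts_map_inr, rights_map_inl, rights_map_inr, map_one, Prod.mk_mul_mk, mul_one, one_mul]
  have hfin : (prodRules R₁ R₂).Finite :=
    ((hfin₁.image _).union (hfin₂.image _)).union (Set.finite_range _)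
  refine (hasFiniteCompleteRewriting_of_normalForm (π := π) hfin
    (isNoetherianRewriting_prodRules hR₁.1 hR₂.1) ?_ ?_
    (fun s => FreeMonoid.map .inl (N₁ s.1) * FreeMonoid.map .inr (N₂ s.2))
    fun w => reflTransGen_prodRules (hN₁ _) (hN₂ _)).of_mulEquiv (f.prodCongr g)
  · rintro ⟨s, t⟩
    obtain ⟨x, rfl⟩ := PresentedMonoid.surjective_mk s
    obtain ⟨y, rfl⟩ := PresentedMonoid.surjective_mk t
    exact ⟨_, hπ x y⟩
  · rintro r ((⟨r, hr, rfl⟩ | ⟨r, hr, rfl⟩) | ⟨p, rfl⟩)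
    · simp only [π, MonoidHom.prod_apply, MonoidHom.comp_apply, Prod.map_fst, Prod.map_snd,
        lefts_map_inl, rights_map_inl, wordClass_eq_of_mem hr]
    · simp only [π, MonoidHom.prod_apply, MonoidHom.comp_apply, Prod.map_fst, Prod.map_snd,
        lefts_map_inr, rights_map_inr, wordClass_eq_of_mem hr]
    · simp only [π, MonoidHom.prod_apply, MonoidHom.comp_apply, map_mul, lefts_of_inl,
        lefts_of_inr, rights_of_inl, rights_of_inr, map_one, Prod.mk_mul_mk, mul_one, one_mul]

theorem hasFiniteCompleteRewriting_of_unique (S : Type u) [Monoid S] [Unique S] :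
    HasFiniteCompleteRewriting S :=
  (hasFiniteCompleteRewriting_freeGroup Empty).of_mulEquiv MulEquiv.ofUnique

/-- The free abelian group of rank two as the square of an infinite cyclic group. -/
noncomputable def freeAbelianGroupFinTwoEquiv :
    Multiplicative (FreeAbelianGroup (Fin 2)) ≃* FreeGroup Unit × FreeGroup Unit :=
  (AddEquiv.toMultiplicative (((FreeAbelianGroup.equivFinsupp (Fin 2)).trans
    (Finsupp.linearEquivFunOnFinite ℤ ℤ (Fin 2)).toAddEquiv).trans
      (LinearEquiv.finTwoArrow ℤ ℤ).toAddEquiv)).trans <|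
    (MulEquiv.prodMultiplicative ℤ ℤ).trans
      (FreeGroup.mulEquivIntOfUnique.prodCongr FreeGroup.mulEquivIntOfUnique).symm

theorem hasFiniteCompleteRewriting_freeAbelianGroup_finTwo :
    HasFiniteCompleteRewriting (Multiplicative (FreeAbelianGroup (Fin 2))) :=
  ((hasFiniteCompleteRewriting_freeGroup Unit).prod
    (hasFiniteCompleteRewriting_freeGroup Unit)).of_mulEquiv freeAbelianGroupFinTwoEquiv.symm

/-! ### Biset monoids -/

/-- The monoid `G ⊔ X ⊔ {0}` of a group `G` and a `G`-`G`-biset `X`, with `X · X = 0`. The two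
actions on `X` are encoded as one action of `G × G`: the element `g` acts from the left as `(g, 1)`
and from the right as `(1, g⁻¹)`. -/
inductive BisetMonoid (G : Type u) (X : Type v) : Type (max u v)
  | unit (g : G)
  | mid (x : X)
  | zero

namespace BisetMonoid

variable {G : Type u} {X : Type v} [Group G]

instance : One (BisetMonoid G X) := ⟨unit 1⟩

theorem one_def : (1 : BisetMonoid G X) = unit 1 := rfl

variable [MulAction (G × G) X]

instance : Mul (BisetMonoid G X) where
  mul
    | unit g, unit g' => unit (g * g')
    | unit g, mid x => mid ((g, (1 : G)) • x)
    | mid x, unit g => mid (((1 : G), g⁻¹) • x)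
    | mid _, mid _ => zero
    | zero, _ => zero
    | _, zero => zero

@[simp] theorem unit_mul_unit (g g' : G) : (unit g * unit g' : BisetMonoid G X) = unit (g * g') :=
  rfl

@[simp] theorem unit_mul_mid (g : G) (x : X) : unit g * mid x = mid ((g, (1 : G)) • x) := rfl

@[simp] theorem mid_mul_unit (x : X) (g : G) : mid x * unit g = mid (((1 : G), g⁻¹) • x) := rfl

@[simp] theorem mid_mul_mid (x y : X) : (mid x * mid y : BisetMonoid G X) = zero := rfl

@[simp] theorem zero_mul (s : BisetMonoid G X) : zero * s = zero := rfl

@[simp] theorem mul_zero (s : BisetMonoid G X) : s * zero = zero := by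
  cases s <;> rfl

instance : Monoid (BisetMonoid G X) where
  mul_assoc s t u := by
    cases s <;> cases t <;> cases u <;> simp [mul_assoc, smul_smul]
  one_mul s := by
    cases s <;> simp [one_def, ← Prod.one_eq_mk]
  mul_one s := by
    cases s <;> simp [one_def, ← Prod.one_eq_mk]

variable (G X) in
/-- The inclusion of the group of units. -/
def unitHom : G →* BisetMonoid G X where
  toFun := unit
  map_one' := rfl
  map_mul' _ _ := rfl

@[simp] theorem unitHom_apply (g : G) : unitHom G X g = unit g := rfl

section Map

variable {Y : Type*} [MulAction (G × G) Y]

/-- The monoid homomorphism induced by a biset homomorphism. -/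
def map (f : X →[G × G] Y) : BisetMonoid G X →* BisetMonoid G Y where
  toFun
    | unit g => unit g
    | mid x => mid (f x)
    | zero => zero
  map_one' := rfl
  map_mul' s t := by cases s <;> cases t <;> simp

variable (f : X →[G × G] Y)

@[simp] theorem map_unit (g : G) : map f (unit g) = unit g := rfl

@[simp] theorem map_mid (x : X) : map f (mid x : BisetMonoid G X) = mid (f x) := rfl

@[simp] theorem map_zero : map f (zero : BisetMonoid G X) = zero := rfl

theorem eq_unit_of_map {s : BisetMonoid G X} {g : G} (h : map f s = unit g) : s = unit g := by
  cases s <;> simp_all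

theorem exists_eq_mid_of_map {s : BisetMonoid G X} {y : Y} (h : map f s = mid y) :
    ∃ x, s = mid x ∧ f x = y := by
  cases s <;> simp_all

theorem map_surjective (hf : Function.Surjective f) : Function.Surjective (map f) := by
  rintro (g | y | _)
  · exact ⟨unit g, rfl⟩
  · obtain ⟨x, rfl⟩ := hf y
    exact ⟨mid x, rfl⟩
  · exact ⟨zero, rfl⟩

end Map

theorem hClass_unit (g : G) : hClass (unit g : BisetMonoid G X) = Set.range unit := by
  ext s
  constructor
  · rintro ⟨h, -⟩
    obtain ⟨⟨t, ht⟩, -⟩ := greenR_iff.1 h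
    cases s <;> cases t <;> simp_all
  · rintro ⟨g', rfl⟩
    exact ⟨greenR_iff.2 ⟨⟨unit (g'⁻¹ * g), by simp⟩, unit (g⁻¹ * g'), by simp⟩,
      greenL_iff.2 ⟨⟨unit (g * g'⁻¹), by simp⟩, unit (g' * g⁻¹), by simp⟩⟩

theorem hClass_zero : hClass (zero : BisetMonoid G X) = {zero} := by
  ext s
  constructor
  · rintro ⟨h, -⟩
    obtain ⟨-, t, ht⟩ := greenR_iff.1 h
    exact ht.symm
  · rintro rfl
    exact mem_hClass_self _

theorem hClass_mid (hleft : ∀ x y : X, ∃ g : G, (g, (1 : G)) • x = y)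
    (hright : ∀ x y : X, ∃ g : G, ((1 : G), g) • x = y) (x : X) :
    hClass (mid x : BisetMonoid G X) = Set.range mid := by
  have hL (x y : X) : ∃ s : BisetMonoid G X, s * mid x = mid y := by
    obtain ⟨g, rfl⟩ := hleft x y
    exact ⟨unit g, rfl⟩
  have hR (x y : X) : ∃ s : BisetMonoid G X, mid x * s = mid y := by
    obtain ⟨g, rfl⟩ := hright x y
    exact ⟨unit g⁻¹, by simp⟩
  ext s
  constructor
  · rintro ⟨h, -⟩
    obtain ⟨⟨t, ht⟩, t', ht'⟩ := greenR_iff.1 h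
    cases s <;> cases t <;> cases t' <;> simp_all
  · rintro ⟨y, rfl⟩
    exact ⟨greenR_iff.2 ⟨hR y x, hR x y⟩, greenL_iff.2 ⟨hL y x, hL x y⟩⟩

end BisetMonoid

/-! ### Schützenberger groups -/

section Schutzenberger

variable {S : Type*} {T : Type*} [Monoid S] [Monoid T]

theorem mul_mem_hClass_of_mul_mem {x y s : S} (hs : x * s ∈ hClass x) (hy : y ∈ hClass x) :
    y * s ∈ hClass x := by
  obtain ⟨t, hst⟩ := (greenR_iff.1 hs.1).1
  obtain ⟨⟨w, hw⟩, w', hw'⟩ := greenL_iff.1 hy.2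
  have hyR : GreenR (y * s) y :=
    greenR_iff.2 ⟨⟨t, by rw [← hw', mul_assoc w', mul_assoc w', hst]⟩, s, rfl⟩
  have hyL : GreenL (y * s) (x * s) :=
    greenL_iff.2 ⟨⟨w, by rw [← mul_assoc, hw]⟩, w', by rw [← mul_assoc, hw']⟩
  exact ⟨hyR.trans hy.1, hyL.trans hs.2⟩

theorem mem_hStab_iff {x s : S} : s ∈ hStab x ↔ x * s ∈ hClass x := by
  refine ⟨fun hs => mul_mem_hClass hs (mem_hClass_self x), fun hs => ?_⟩
  obtain ⟨t, hst⟩ := (greenR_iff.1 hs.1).1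
  obtain ⟨⟨w, hw⟩, w', hw'⟩ := greenL_iff.1 hs.2
  have hts : x * t * s = x := by
    rw [← hw, mul_assoc w, mul_assoc w, hst, hw]
  have hwt : w * x = x * t :=
    calc w * x = w * (x * s) * t := by rw [mul_assoc w, hst]
      _ = x * t := by rw [hw]
  have ht : x * t ∈ hClass x :=
    ⟨greenR_iff.2 ⟨⟨s, hts⟩, t, rfl⟩,
      greenL_iff.2 ⟨⟨w', by rw [← mul_assoc, hw', hst]⟩, w, hwt⟩⟩
  apply Set.Subset.antisymm
  · rintro _ ⟨y, hy, rfl⟩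
    exact mul_mem_hClass_of_mul_mem hs hy
  · intro y hy
    obtain ⟨v, hv⟩ := (greenL_iff.1 hy.2).2
    exact ⟨y * t, mul_mem_hClass_of_mul_mem ht hy, by
      simp only [← hv, mul_assoc v, hts]⟩

/-- The recognition principle for Schützenberger groups: the elements of a group `G`, acting through
`θ`, reach the whole of `x · Stab(H)`, so the Schützenberger group is the quotient of `G` by the
stabilizer of `x`. -/
theorem nonempty_schutzenbergerGroup_mulEquiv {G Q : Type*} [Group G] [Group Q] (θ : G →* S)
    {f : G →* Q} (hf : Function.Surjective f) {x : S}
    (hx : ∀ s, x * s ∈ hClass x ↔ ∃ g, x * s = x * θ g) (hker : ∀ g, x * θ g = x ↔ f g = 1) :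
    Nonempty (SchutzenbergerGroup x ≃* Q) := by
  have hθ (g : G) : θ g ∈ hStab x := mem_hStab_iff.2 ((hx _).2 ⟨g, rfl⟩)
  let Θ : G →* SchutzenbergerGroup x := (schutzenbergerCon x).mk'.comp (θ.codRestrict _ hθ)
  have hΘ : Function.Surjective Θ := by
    intro y
    induction y using Con.induction_on with
    | H s =>
      obtain ⟨g, hg⟩ := (hx s).1 (mem_hStab_iff.1 s.2)
      exact ⟨g, (Con.eq _).2 hg.symm⟩
  have hk : Θ.ker = f.ker := by
    ext g
    rw [MonoidHom.mem_ker, MonoidHom.mem_ker, ← hker]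
    refine (Con.eq _).trans ?_
    change x * θ g = x * 1 ↔ _
    rw [mul_one]
  exact ⟨(QuotientGroup.quotientKerEquivOfSurjective Θ hΘ).symm.trans
    ((QuotientGroup.quotientMulEquivOfEq hk).trans
      (QuotientGroup.quotientKerEquivOfSurjective f hf))⟩

theorem GreenH.map {x y : S} (h : GreenH x y) (e : S →* T) : GreenH (e x) (e y) := by
  obtain ⟨⟨s, hs⟩, t, ht⟩ := greenR_iff.1 h.1
  obtain ⟨⟨s', hs'⟩, t', ht'⟩ := greenL_iff.1 h.2
  exact ⟨greenR_iff.2 ⟨⟨e s, by rw [← map_mul, hs]⟩, e t, by rw [← map_mul, ht]⟩,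
    greenL_iff.2 ⟨⟨e s', by rw [← map_mul, hs']⟩, e t', by rw [← map_mul, ht']⟩⟩

theorem hClass_eq_preimage (e : S ≃* T) (x : S) : hClass x = e ⁻¹' hClass (e x) := by
  refine Set.Subset.antisymm (fun y h => GreenH.map h (e : S →* T)) fun y h => ?_
  have h' := GreenH.map h (e.symm : T →* S)
  rwa [MonoidHom.coe_coe, e.symm_apply_apply, e.symm_apply_apply] at h'

theorem isHClass_iff_exists_preimage (e : S ≃* T) {H : Set S} :
    IsHClass H ↔ ∃ y : T, H = e ⁻¹' hClass y := by
  simp only [IsHClass, hClass_eq_preimage e, e.surjective.exists]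

theorem map_hStab (e : S ≃* T) (x : S) : (hStab x).map e.toMonoidHom = hStab (e x) := by
  ext t
  rw [Submonoid.mem_map_equiv, mem_hStab_iff, mem_hStab_iff, hClass_eq_preimage e]
  simp

/-- Isomorphic monoids have isomorphic Schützenberger groups. -/
def schutzenbergerGroupCongr (e : S ≃* T) (x : S) :
    SchutzenbergerGroup x ≃* SchutzenbergerGroup (e x) :=
  Con.congr ((e.submonoidMap (hStab x)).trans (MulEquiv.submonoidCongr (map_hStab e x))) <| by
    ext s t
    exact e.injective.eq_iff.symm.trans (by rw [map_mul, map_mul]; rfl)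

end Schutzenberger

/-! ### The biset of a group homomorphism -/

/-- The codomain of `f : G →* Q` as a `G`-`G`-biset, on which `G` acts from both sides through `f`
and translations. -/
def TranslationBiset {G : Type u} {Q : Type v} [Group G] [Group Q] (_f : G →* Q) : Type v := Q

namespace TranslationBiset

variable {G : Type u} {Q : Type v} [Group G] [Group Q] {f : G →* Q}

instance : Group (TranslationBiset f) := inferInstanceAs (Group Q)

variable (f) in
/-- The homomorphism `f`, with values in the biset. -/
def of : G →* TranslationBiset f := f

theorem of_surjective (hf : Function.Surjective f) : Function.Surjective (of f) := hf

instance : MulAction (G × G) (TranslationBiset f) where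
  smul p q := of f p.1 * q * (of f p.2)⁻¹
  one_smul q := by change of f 1 * q * (of f 1)⁻¹ = q; simp
  mul_smul p p' q := by
    change of f (p.1 * p'.1) * q * (of f (p.2 * p'.2))⁻¹ =
      of f p.1 * (of f p'.1 * q * (of f p'.2)⁻¹) * (of f p.2)⁻¹
    simp [mul_assoc]

theorem smul_def (p : G × G) (q : TranslationBiset f) : p • q = of f p.1 * q * (of f p.2)⁻¹ := rfl

theorem mem_stabilizer_one_iff {p : G × G} :
    p ∈ MulAction.stabilizer (G × G) (1 : TranslationBiset f) ↔ f p.1 = f p.2 := by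
  rw [MulAction.mem_stabilizer_iff, smul_def, mul_one, mul_inv_eq_one]
  rfl

theorem exists_left_smul_eq (hf : Function.Surjective f) (x y : TranslationBiset f) :
    ∃ g : G, (g, (1 : G)) • x = y := by
  obtain ⟨g, hg⟩ := of_surjective hf (y * x⁻¹)
  exact ⟨g, by simp [smul_def, hg]⟩

theorem exists_right_smul_eq (hf : Function.Surjective f) (x y : TranslationBiset f) :
    ∃ g : G, ((1 : G), g) • x = y := by
  obtain ⟨g, hg⟩ := of_surjective hf (y⁻¹ * x)
  exact ⟨g, by simp [smul_def, hg]⟩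

end TranslationBiset

namespace BisetMonoid

open TranslationBiset

section Schutzenberger

variable {G : Type u} {X : Type v} [Group G] [MulAction (G × G) X]

theorem nonempty_schutzenbergerGroup_unit (g : G) :
    Nonempty (SchutzenbergerGroup (unit g : BisetMonoid G X) ≃* G) := by
  refine nonempty_schutzenbergerGroup_mulEquiv (unitHom G X) (f := .id G) Function.surjective_id
    (fun s => ?_) fun g' => by simp
  rw [hClass_unit]
  constructor
  · rintro ⟨g', hg'⟩
    exact ⟨g⁻¹ * g', by simp [← hg']⟩
  · rintro ⟨g', hg'⟩
    exact ⟨g * g', hg'.symm⟩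

theorem nonempty_schutzenbergerGroup_zero :
    Nonempty (SchutzenbergerGroup (zero : BisetMonoid G X) ≃* Unit) :=
  nonempty_schutzenbergerGroup_mulEquiv (unitHom G X) (f := 1) (fun _ => ⟨1, rfl⟩)
    (fun s => by simp [hClass_zero]) fun g => by simp

end Schutzenberger

variable {G : Type u} {Q : Type v} [Group G] [Group Q] {f : G →* Q}

theorem nonempty_schutzenbergerGroup_mid (hf : Function.Surjective f) (q : TranslationBiset f) :
    Nonempty (SchutzenbergerGroup (mid q : BisetMonoid G (TranslationBiset f)) ≃* Q) := by
  refine nonempty_schutzenbergerGroup_mulEquiv (unitHom G _) hf (fun s => ?_) fun g => ?_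
  · rw [hClass_mid (exists_left_smul_eq hf) (exists_right_smul_eq hf)]
    constructor
    · rintro ⟨q', hq'⟩
      obtain ⟨g, rfl⟩ := exists_right_smul_eq hf q q'
      exact ⟨g⁻¹, by simp [← hq']⟩
    · rintro ⟨g, hg⟩
      exact ⟨_, hg.symm⟩
  · rw [unitHom_apply, mid_mul_unit, mid.injEq, smul_def]
    simp only [map_one, one_mul, map_inv, inv_inv, mul_eq_left]
    rfl

end BisetMonoid

namespace BisetMonoid

open TranslationBiset

variable {G : Type u} {Q : Type v} [Group G] [Group Q] {f : G →* Q}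

theorem mid_one_mul_unit (g : G) :
    (mid 1 * unit g : BisetMonoid G (TranslationBiset f)) = mid (of f g) := by
  simp [smul_def]

variable {S : Type*} [Monoid S]

theorem hom_ext (hf : Function.Surjective f) {φ ψ : BisetMonoid G (TranslationBiset f) →* S}
    (hunit : φ.comp (unitHom G _) = ψ.comp (unitHom G _)) (hmid : φ (mid 1) = ψ (mid 1)) :
    φ = ψ := by
  ext s
  cases s with
  | unit g => exact DFunLike.congr_fun hunit g
  | mid q =>
    obtain ⟨g, rfl⟩ := of_surjective hf q
    rw [← mid_one_mul_unit, map_mul, map_mul, hmid]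
    exact congrArg _ (DFunLike.congr_fun hunit g)
  | zero => rw [← mid_mul_mid 1 1, map_mul, map_mul, hmid]

/-- The homomorphism that is `θ` on the units and sends `mid 1` to `h`. -/
noncomputable def lift (hf : Function.Surjective f) (θ : G →* S) (h : S)
    (hcomm : ∀ g, Commute h (θ g)) (hmul : ∀ c d, f c = f d → h * θ c = h * θ d)
    (hsq : ∀ g, h * h * θ g = h * h) (hcube : h * h * h = h * h) :
    BisetMonoid G (TranslationBiset f) →* S where
  toFun
    | unit g => θ g
    | mid q => h * θ (Function.surjInv (of_surjective hf) q)
    | zero => h * h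
  map_one' := map_one θ
  map_mul' s t := by
    have hmid (q : TranslationBiset f) (g : G) (hg : of f g = q) :
        h * θ (Function.surjInv (of_surjective hf) q) = h * θ g :=
      hmul _ _ ((Function.surjInv_eq (of_surjective hf) q).trans hg.symm)
    have hsq' (g : G) : θ g * (h * h) = h * h :=
      ((hcomm g).mul_left (hcomm g)).eq.symm.trans (hsq g)
    cases s with
    | unit g =>
      cases t with
      | unit g' => exact map_mul θ g g'
      | mid q =>
        obtain ⟨g', rfl⟩ := of_surjective hf q
        refine (hmid _ (g * g') (by simp [smul_def])).trans ?_
        simp only [hmid _ g' rfl, map_mul, ← mul_assoc, (hcomm g).eq]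
      | zero => exact (hsq' g).symm
    | mid q =>
      cases t with
      | unit g =>
        obtain ⟨g', rfl⟩ := of_surjective hf q
        refine (hmid _ (g' * g) (by simp [smul_def])).trans ?_
        simp only [hmid _ g' rfl, map_mul, mul_assoc]
      | mid q' => simp only [(hcomm _).symm.mul_mul_mul_comm, ← map_mul, hsq]
      | zero => simp only [mul_assoc, hsq', mul_assoc h h h ▸ hcube]
    | zero =>
      cases t with
      | unit g => exact (hsq g).symm
      | mid q => simp only [← mul_assoc, hcube, hsq]
      | zero => simp only [← mul_assoc, hcube]

theorem lift_mid_one (hf : Function.Surjective f) (θ : G →* S) (h : S)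
    (hcomm : ∀ g, Commute h (θ g)) (hmul : ∀ c d, f c = f d → h * θ c = h * θ d)
    (hsq : ∀ g, h * h * θ g = h * h) (hcube : h * h * h = h * h) :
    lift hf θ h hcomm hmul hsq hcube (mid 1) = h := by
  have h1 : f (Function.surjInv (of_surjective hf) 1) = f 1 :=
    (Function.surjInv_eq (of_surjective hf) 1).trans (map_one f).symm
  exact (hmul _ _ h1).trans (by rw [map_one, mul_one])

end BisetMonoid

section FreeGroup

open scoped commutatorElement

variable {α : Type*} {S : Type*} [Monoid S] {φ : FreeGroup α →* S} {h : S}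

theorem commute_map_freeGroup (hcomm : ∀ i, Commute h (φ (.of i))) (c : FreeGroup α) :
    Commute h (φ c) := by
  induction c using FreeGroup.induction_on with
  | C1 => simp
  | of i => exact hcomm i
  | inv_of i hi => exact Commute.units_inv_right (u := φ.toHomUnits (.of i)) hi
  | mul c d hc hd => rw [map_mul]; exact hc.mul_right hd

theorem mul_map_freeGroup_eq_self (hfix : ∀ i, h * φ (.of i) = h) (c : FreeGroup α) :
    h * φ c = h := by
  induction c using FreeGroup.induction_on with
  | C1 => simp
  | of i => exact hfix i
  | inv_of i hi =>
    nth_rw 1 [← hi]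
    rw [mul_assoc, ← map_mul, mul_inv_cancel, map_one, mul_one]
  | mul c d hc hd => rw [map_mul, ← mul_assoc, hc, hd]

theorem commutator_freeGroup_le {N : Subgroup (FreeGroup α)} [N.Normal]
    (hN : ∀ i j : α, ⁅FreeGroup.of i, FreeGroup.of j⁆ ∈ N) : commutator (FreeGroup α) ≤ N := by
  let π := QuotientGroup.mk' N
  have hgen (i j : α) : Commute (π (.of i)) (π (.of j)) := by
    rw [← commutatorElement_eq_one_iff_commute, ← map_commutatorElement]
    exact (QuotientGroup.eq_one_iff _).2 (hN i j)
  have hπ (c d : FreeGroup α) : Commute (π c) (π d) :=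
    commute_map_freeGroup (fun j => (commute_map_freeGroup (fun i => (hgen j i)) c).symm) d
  rw [commutator_def, Subgroup.commutator_le]
  intro c _ d _
  rw [← QuotientGroup.eq_one_iff]
  exact (map_commutatorElement π c d).trans (hπ c d).commutator_eq

theorem normal_comap_stabilizer {G : Type*} [Group G] {φ : G →* S} (hcomm : ∀ g, Commute h (φ g)) :
    ((MulAction.stabilizer Sˣ h).comap φ.toHomUnits).Normal where
  conj_mem n hn g := by
    have hn' : φ n * h = h := hn
    change φ (g * n * g⁻¹) * h = h
    rw [map_mul, mul_assoc, ← (hcomm g⁻¹).eq, map_mul, mul_assoc, ← mul_assoc (φ n), hn',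
      (hcomm g⁻¹).eq, ← mul_assoc, ← map_mul, mul_inv_cancel, map_one, one_mul]

theorem mul_map_freeGroup_eq_of_abelianization_eq (hcomm : ∀ i, Commute h (φ (.of i)))
    (hmul : ∀ i j, h * φ (.of i) * φ (.of j) = h * φ (.of j) * φ (.of i)) {c d : FreeGroup α}
    (hcd : Abelianization.of c = Abelianization.of d) : h * φ c = h * φ d := by
  have hcomm' := commute_map_freeGroup hcomm
  let N := (MulAction.stabilizer Sˣ h).comap φ.toHomUnits
  have : N.Normal := normal_comap_stabilizer hcomm'
  have hN : commutator (FreeGroup α) ≤ N := by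
    refine commutator_freeGroup_le fun i j => ?_
    change φ ⁅FreeGroup.of i, FreeGroup.of j⁆ * h = h
    calc φ ⁅FreeGroup.of i, FreeGroup.of j⁆ * h
        = h * φ (.of i) * φ (.of j) * φ ((.of j * .of i)⁻¹) := by
          rw [← (hcomm' _).eq]
          simp only [commutatorElement_def, mul_inv_rev, map_mul, mul_assoc]
      _ = h := by
          rw [hmul, mul_assoc h, ← map_mul, mul_assoc, ← map_mul, mul_inv_cancel, map_one, mul_one]
  have hcd' : c * d⁻¹ ∈ N := hN <| by
    rw [← Abelianization.ker_of, MonoidHom.mem_ker, map_mul, map_inv, hcd, mul_inv_cancel]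
  have hfix : φ (c * d⁻¹) * h = h := hcd'
  rw [(hcomm' c).eq, (hcomm' d).eq, ← inv_mul_cancel_right c d, map_mul, mul_assoc,
    ← (hcomm' d).eq, ← mul_assoc, hfix]

end FreeGroup

/-! ### The structure of the monoid `M` -/

theorem abelianization_of_surjective {G : Type*} [Group G] :
    Function.Surjective (Abelianization.of : G →* Abelianization G) :=
  QuotientGroup.mk_surjective

open scoped commutatorElement in
theorem abelianization_of_commutator {G : Type*} [Group G] (c d : G) :
    Abelianization.of ⁅c, d⁆ = 1 := by
  rw [map_commutatorElement, commutatorElement_eq_one_iff_mul_comm, mul_comm]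

namespace MonoidM

open BisetMonoid

/-- A generator as an element of `M`. -/
def gen (x : Gen) : MonoidM := wordClass Gen.relations (FreeMonoid.of x)

section Relations

variable {x y : FreeMonoid Gen}

theorem wordClass_eq (h : (x, y) ∈ Gen.relations) :
    wordClass Gen.relations x = wordClass Gen.relations y :=
  wordClass_eq_of_mem h

theorem wordClass_H : wordClass _ Gen.H = gen .h := rfl

theorem commute_gen_h (hx : x ∈ Gen.units) : Commute (gen .h) (wordClass _ x) := by
  have h := wordClass_eq (.inl (.inl (.inl (.inr ⟨x, hx, rfl⟩))))
  simp only [map_mul, wordClass_H] at h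
  exact h.symm

theorem gen_h_mul_mul_comm (hx : x ∈ Gen.units) (hy : y ∈ Gen.units) :
    gen .h * wordClass _ x * wordClass _ y = gen .h * wordClass _ y * wordClass _ x := by
  simpa only [map_mul, wordClass_H] using wordClass_eq (.inl (.inl (.inr ⟨x, hx, y, hy, rfl⟩)))

theorem gen_h_mul_gen_h_mul (hx : x ∈ Gen.units) :
    gen .h * gen .h * wordClass _ x = gen .h * gen .h := by
  simpa only [pow_two, map_mul, wordClass_H] using wordClass_eq (.inl (.inr ⟨x, hx, rfl⟩))

theorem gen_h_cube : gen .h * gen .h * gen .h = gen .h * gen .h := by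
  simpa only [pow_succ, pow_zero, one_mul, map_mul, wordClass_H] using wordClass_eq (.inr rfl)

end Relations

/-- The units `a` and `b` of `M`. -/
def genUnit : Fin 2 → MonoidMˣ :=
  ![⟨gen .a, gen .a', wordClass_eq (.inl (.inl (.inl (.inl (by simp))))),
      wordClass_eq (.inl (.inl (.inl (.inl (by simp)))))⟩,
    ⟨gen .b, gen .b', wordClass_eq (.inl (.inl (.inl (.inl (by simp))))),
      wordClass_eq (.inl (.inl (.inl (.inl (by simp)))))⟩]

theorem exists_wordClass_eq_genUnit (i : Fin 2) :
    ∃ x ∈ Gen.units, wordClass _ x = (genUnit i : MonoidM) := by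
  fin_cases i
  · exact ⟨.of .a, by simp [Gen.units], rfl⟩
  · exact ⟨.of .b, by simp [Gen.units], rfl⟩

/-- The homomorphism from the free group of rank two to `M`. -/
def ofFreeGroup : FreeGroup (Fin 2) →* MonoidM := (Units.coeHom _).comp (FreeGroup.lift genUnit)

@[simp] theorem ofFreeGroup_of (i : Fin 2) : ofFreeGroup (.of i) = genUnit i :=
  congrArg Units.val FreeGroup.lift_apply_of

@[simp] theorem ofFreeGroup_of_inv (i : Fin 2) : ofFreeGroup (.of i)⁻¹ = (genUnit i)⁻¹.val := by
  simp [ofFreeGroup]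

/-- The biset monoid that serves as a model of `M`. -/
abbrev Model : Type :=
  BisetMonoid (FreeGroup (Fin 2)) (TranslationBiset (Abelianization.of (G := FreeGroup (Fin 2))))

/-- The generators of `M` in its model. -/
def genModel : Gen → Model
  | .a => unit (.of 0)
  | .a' => unit (.of 0)⁻¹
  | .b => unit (.of 1)
  | .b' => unit (.of 1)⁻¹
  | .h => mid 1

theorem exists_lift_genModel_eq_unit {x : FreeMonoid Gen} (hx : x ∈ Gen.units) :
    ∃ g, FreeMonoid.lift genModel x = unit g := by
  rcases hx with rfl | rfl | rfl | rfl <;> exact ⟨_, rfl⟩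

theorem lift_genModel_eq (x y : FreeMonoid Gen) (h : (x, y) ∈ Gen.relations) :
    FreeMonoid.lift genModel x = FreeMonoid.lift genModel y := by
  have hab (g g' : FreeGroup (Fin 2)) :
      TranslationBiset.of Abelianization.of g * TranslationBiset.of Abelianization.of g' =
        TranslationBiset.of Abelianization.of g' * TranslationBiset.of Abelianization.of g :=
    mul_comm (Abelianization.of g) (Abelianization.of g')
  have hH : FreeMonoid.lift genModel Gen.H = mid 1 := rfl
  rcases h with (((h | ⟨z, hz, h⟩) | ⟨z, hz, w, hw, h⟩) | ⟨z, hz, h⟩) | h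
  · rcases h with h | h | h | h <;> obtain ⟨rfl, rfl⟩ := Prod.ext_iff.1 h <;>
      simp [genModel, one_def]
  all_goals obtain ⟨rfl, rfl⟩ := Prod.ext_iff.1 h
  · obtain ⟨g, hg⟩ := exists_lift_genModel_eq_unit hz
    simp [hg, hH, TranslationBiset.smul_def]
  · obtain ⟨g, hg⟩ := exists_lift_genModel_eq_unit hz
    obtain ⟨g', hg'⟩ := exists_lift_genModel_eq_unit hw
    simpa [hg, hg', hH, TranslationBiset.smul_def] using hab g g'
  · obtain ⟨g, hg⟩ := exists_lift_genModel_eq_unit hz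
    simp [hg, hH, pow_two]
  · simp [hH, pow_succ]

/-- The homomorphism from `M` to its model. -/
def toModel : MonoidM →* Model :=
  PresentedMonoid.lift genModel lift_genModel_eq

theorem commute_gen_h_genUnit (i : Fin 2) : Commute (gen .h) (ofFreeGroup (.of i)) := by
  obtain ⟨x, hx, h⟩ := exists_wordClass_eq_genUnit i
  rw [ofFreeGroup_of, ← h]
  exact commute_gen_h hx

theorem gen_h_mul_ofFreeGroup_eq (c d : FreeGroup (Fin 2))
    (hcd : Abelianization.of c = Abelianization.of d) :
    gen .h * ofFreeGroup c = gen .h * ofFreeGroup d :=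
  mul_map_freeGroup_eq_of_abelianization_eq commute_gen_h_genUnit (fun i j => by
    obtain ⟨x, hx, h⟩ := exists_wordClass_eq_genUnit i
    obtain ⟨y, hy, h'⟩ := exists_wordClass_eq_genUnit j
    rw [ofFreeGroup_of, ofFreeGroup_of, ← h, ← h']
    exact gen_h_mul_mul_comm hx hy) hcd

theorem gen_h_mul_gen_h_mul_ofFreeGroup (c : FreeGroup (Fin 2)) :
    gen .h * gen .h * ofFreeGroup c = gen .h * gen .h :=
  mul_map_freeGroup_eq_self (fun i => by
    obtain ⟨x, hx, h⟩ := exists_wordClass_eq_genUnit i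
    rw [ofFreeGroup_of, ← h]
    exact gen_h_mul_gen_h_mul hx) c

/-- The homomorphism from the model to `M`. -/
noncomputable def ofModel : Model →* MonoidM :=
  lift abelianization_of_surjective ofFreeGroup (gen .h)
    (commute_map_freeGroup commute_gen_h_genUnit) gen_h_mul_ofFreeGroup_eq
    gen_h_mul_gen_h_mul_ofFreeGroup gen_h_cube

theorem ofModel_mid_one : ofModel (mid 1) = gen .h :=
  lift_mid_one abelianization_of_surjective ofFreeGroup (gen .h)
    (commute_map_freeGroup commute_gen_h_genUnit) gen_h_mul_ofFreeGroup_eq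
    gen_h_mul_gen_h_mul_ofFreeGroup gen_h_cube

/-- The isomorphism between `M` and its model. -/
noncomputable def modelEquiv : MonoidM ≃* Model :=
  MonoidHom.toMulEquiv toModel ofModel
    (PresentedMonoid.ext _ fun x => by
      cases x
      case h => exact ofModel_mid_one
      case a => exact ofFreeGroup_of 0
      case a' => exact ofFreeGroup_of_inv 0
      case b => exact ofFreeGroup_of 1
      case b' => exact ofFreeGroup_of_inv 1)
    (hom_ext abelianization_of_surjective
      (by
        ext i
        fin_cases i
        · exact congrArg toModel (ofFreeGroup_of 0)
        · exact congrArg toModel (ofFreeGroup_of 1))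
      (congrArg toModel ofModel_mid_one))

/-- The abelianization of the free group of rank two is the free abelian group of rank two. -/
def abelianizationEquiv :
    Abelianization (FreeGroup (Fin 2)) ≃* Multiplicative (FreeAbelianGroup (Fin 2)) :=
  (MulEquiv.toMultiplicative_toAdditive (G := Abelianization (FreeGroup (Fin 2)))).symm

theorem nonempty_schutzenbergerGroup_of_modelEquiv_eq_unit {x : MonoidM} {g : FreeGroup (Fin 2)}
    (hx : modelEquiv x = unit g) : Nonempty (SchutzenbergerGroup x ≃* FreeGroup (Fin 2)) := by
  obtain ⟨e⟩ := nonempty_schutzenbergerGroup_unit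
    (X := TranslationBiset (Abelianization.of (G := FreeGroup (Fin 2)))) g
  exact ⟨(schutzenbergerGroupCongr modelEquiv x).trans (hx ▸ e)⟩

theorem nonempty_schutzenbergerGroup_of_modelEquiv_eq_mid {x : MonoidM} {q : TranslationBiset _}
    (hx : modelEquiv x = mid q) :
    Nonempty (SchutzenbergerGroup x ≃* Multiplicative (FreeAbelianGroup (Fin 2))) := by
  obtain ⟨e⟩ := nonempty_schutzenbergerGroup_mid abelianization_of_surjective q
  exact ⟨((schutzenbergerGroupCongr modelEquiv x).trans (hx ▸ e)).trans abelianizationEquiv⟩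

theorem nonempty_schutzenbergerGroup_of_modelEquiv_eq_zero {x : MonoidM}
    (hx : modelEquiv x = zero) : Nonempty (SchutzenbergerGroup x ≃* Unit) := by
  obtain ⟨e⟩ := nonempty_schutzenbergerGroup_zero (G := FreeGroup (Fin 2))
    (X := TranslationBiset (Abelianization.of (G := FreeGroup (Fin 2))))
  exact ⟨(schutzenbergerGroupCongr modelEquiv x).trans (hx ▸ e)⟩

theorem hasFiniteCompleteRewriting_schutzenbergerGroup (x : MonoidM) :
    HasFiniteCompleteRewriting (SchutzenbergerGroup x) := by
  cases hx : modelEquiv x with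
  | unit g =>
    obtain ⟨e⟩ := nonempty_schutzenbergerGroup_of_modelEquiv_eq_unit hx
    exact (hasFiniteCompleteRewriting_freeGroup (Fin 2)).of_mulEquiv e.symm
  | mid q =>
    obtain ⟨e⟩ := nonempty_schutzenbergerGroup_of_modelEquiv_eq_mid hx
    exact hasFiniteCompleteRewriting_freeAbelianGroup_finTwo.of_mulEquiv e.symm
  | zero =>
    obtain ⟨e⟩ := nonempty_schutzenbergerGroup_of_modelEquiv_eq_zero hx
    exact (hasFiniteCompleteRewriting_of_unique Unit).of_mulEquiv e.symm

theorem isHClass_iff {H : Set MonoidM} :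
    IsHClass H ↔ H = modelEquiv ⁻¹' {zero} ∨ H = modelEquiv ⁻¹' Set.range mid ∨
      H = modelEquiv ⁻¹' Set.range unit := by
  rw [isHClass_iff_exists_preimage modelEquiv]
  have hmid := hClass_mid
    (TranslationBiset.exists_left_smul_eq (abelianization_of_surjective (G := FreeGroup (Fin 2))))
    (TranslationBiset.exists_right_smul_eq abelianization_of_surjective)
  constructor
  · rintro ⟨g | q | _, rfl⟩
    · exact .inr (.inr (congrArg _ (hClass_unit g)))
    · exact .inr (.inl (congrArg _ (hmid q)))
    · exact .inl (congrArg _ hClass_zero)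
  · rintro (rfl | rfl | rfl)
    · exact ⟨zero, congrArg _ hClass_zero.symm⟩
    · exact ⟨mid 1, congrArg _ (hmid 1).symm⟩
    · exact ⟨unit 1, congrArg _ (hClass_unit 1).symm⟩

theorem exists_hClasses : ∃ H₁ H₂ H₃ : Set MonoidM,
    H₁ ≠ H₂ ∧ H₁ ≠ H₃ ∧ H₂ ≠ H₃ ∧
    {H : Set MonoidM | IsHClass H} = {H₁, H₂, H₃} ∧
    (∀ x ∈ H₁, Nonempty (SchutzenbergerGroup x ≃* Unit)) ∧
    (∀ x ∈ H₂, Nonempty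
      (SchutzenbergerGroup x ≃* Multiplicative (FreeAbelianGroup (Fin 2)))) ∧
    (∀ x ∈ H₃, Nonempty (SchutzenbergerGroup x ≃* FreeGroup (Fin 2))) := by
  have hinj : Function.Injective (Set.preimage modelEquiv) :=
    modelEquiv.surjective.preimage_injective
  refine ⟨_, _, _, hinj.ne fun h => ?_, hinj.ne fun h => ?_, hinj.ne fun h => ?_,
    Set.ext fun _ => isHClass_iff, fun x hx => ?_, ?_, ?_⟩
  · obtain ⟨q, hq⟩ := h.le (Set.mem_singleton zero)
    cases hq
  · obtain ⟨q, hq⟩ := h.le (Set.mem_singleton zero)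
    cases hq
  · obtain ⟨q, hq⟩ := h.le (Set.mem_range_self 1)
    cases hq
  · exact nonempty_schutzenbergerGroup_of_modelEquiv_eq_zero hx
  · rintro x ⟨q, hq⟩
    exact nonempty_schutzenbergerGroup_of_modelEquiv_eq_mid hq.symm
  · rintro x ⟨g, hg⟩
    exact nonempty_schutzenbergerGroup_of_modelEquiv_eq_unit hg.symm

end MonoidM

/-! ### Labelled derivation graphs -/

namespace DerivationGraph

variable {A : Type u} {R : Set (FreeMonoid A × FreeMonoid A)} {x y z : DerivationGraph R}

section Label

variable {K : Type v} [Group K] (l : R → K)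

/-- The label of an edge of the derivation graph with respect to a labelling of the rules by
elements of a group. -/
def edgeLabel (e : x ⟶ y) : K :=
  if Edge.sign e then l (Edge.rule e) else (l (Edge.rule e))⁻¹

theorem edgeLabel_reverse (e : x ⟶ y) :
    edgeLabel l (Quiver.reverse e) = (edgeLabel l e)⁻¹ := by
  obtain ⟨w, r, ε, w', hx, hy⟩ := e
  cases ε
  · exact (inv_inv (l r)).symm
  · rfl

/-- The product of the labels of the edges of a path. -/
def pathLabel (p : Quiver.Path x y) : K := p.weight (edgeLabel l)

@[simp] theorem pathLabel_nil : pathLabel l (.nil : Quiver.Path x x) = 1 :=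
  Quiver.Path.weight_nil _ x

@[simp] theorem pathLabel_cons (p : Quiver.Path x y) (e : y ⟶ z) :
    pathLabel l (p.cons e) = pathLabel l p * edgeLabel l e :=
  Quiver.Path.weight_cons _ p e

@[simp] theorem pathLabel_toPath (e : x ⟶ y) : pathLabel l e.toPath = edgeLabel l e := by
  rw [Quiver.Hom.toPath, pathLabel_cons, pathLabel_nil, one_mul]

@[simp] theorem pathLabel_comp (p : Quiver.Path x y) (q : Quiver.Path y z) :
    pathLabel l (p.comp q) = pathLabel l p * pathLabel l q :=
  Quiver.Path.weight_comp _ p q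

@[simp] theorem pathLabel_reverse (p : Quiver.Path x y) :
    pathLabel l p.reverse = (pathLabel l p)⁻¹ := by
  induction p with
  | nil => simp [Quiver.Path.reverse]
  | cons p e ih => simp [Quiver.Path.reverse, ih, edgeLabel_reverse]

@[simp] theorem pathLabel_mapPath_act (w z : DerivationGraph R) (p : Quiver.Path x y) :
    pathLabel l ((act w z).mapPath p) = pathLabel l p := by
  induction p with
  | nil => simp
  | cons p e ih =>
    rw [Prefunctor.mapPath_cons, pathLabel_cons, pathLabel_cons, ih]
    rfl

theorem exists_pathLabel_mul_right (p : Quiver.Path x y) (w : DerivationGraph R) :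
    ∃ q : Quiver.Path (x * w) (y * w), pathLabel l q = pathLabel l p := by
  have h : ∃ q : Quiver.Path (1 * x * w) (1 * y * w), pathLabel l q = pathLabel l p :=
    ⟨(act 1 w).mapPath p, pathLabel_mapPath_act l 1 w p⟩
  rwa [one_mul, one_mul] at h

theorem exists_pathLabel_mul_left (p : Quiver.Path x y) (w : DerivationGraph R) :
    ∃ q : Quiver.Path (w * x) (w * y), pathLabel l q = pathLabel l p := by
  have h : ∃ q : Quiver.Path (w * x * 1) (w * y * 1), pathLabel l q = pathLabel l p :=
    ⟨(act w 1).mapPath p, pathLabel_mapPath_act l w 1 p⟩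
  rwa [mul_one, mul_one] at h

theorem exists_pathLabel_square {u v w : DerivationGraph R} (p : Quiver.Path w (u * w))
    (q : Quiver.Path w (w * v)) : ∃ p' q' : Quiver.Path w (u * w * v),
      pathLabel l p' = pathLabel l p * pathLabel l q ∧
      pathLabel l q' = pathLabel l q * pathLabel l p := by
  obtain ⟨p', hp⟩ := exists_pathLabel_mul_right l p v
  have h := exists_pathLabel_mul_left l q u
  rw [← mul_assoc] at h
  obtain ⟨q', hq⟩ := h
  exact ⟨p.comp q', q.comp p', by rw [pathLabel_comp, hq], by rw [pathLabel_comp, hp]⟩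

end Label

theorem nonempty_path_of_wordClass_eq {x y : FreeMonoid A} (h : wordClass R x = wordClass R y) :
    Nonempty (Quiver.Path (V := DerivationGraph R) x y) := by
  have hxy := PresentedMonoid.mk_eq_mk_iff.1 h
  clear h
  induction hxy with
  | of x y h =>
    obtain ⟨e, -⟩ := exists_edge_of_rewrites (Rewrites.of_mem h)
    exact ⟨e.toPath⟩
  | refl x => exact ⟨.nil⟩
  | symm _ ih => exact ih.map Quiver.Path.reverse
  | trans _ _ ih ih' => exact ih.map2 Quiver.Path.comp ih'
  | mul _ _ ih ih' =>
    obtain ⟨p⟩ := ih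
    obtain ⟨q⟩ := ih'
    obtain ⟨p', -⟩ := exists_pathLabel_mul_right (fun _ => (1 : Unit)) p _
    obtain ⟨q', -⟩ := exists_pathLabel_mul_left (fun _ => (1 : Unit)) q _
    exact ⟨p'.comp q'⟩

end DerivationGraph

/-! ### An obstruction to finite derivation type -/

namespace BisetMonoid

variable {G : Type*} {K L : Type*} [Group G] [Group K] [Group L]

/-- The element `m` of `K` lifts, along `φ : K →* L` and `ψ : G × G →* L`, the right translation
that takes `s` to `t`. Elements of `G` are only translated to themselves, and only by `1`. -/
inductive LiftsTranslation (φ : K →* L) (ψ : G × G →* L) :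
    K → BisetMonoid G (G × G) → BisetMonoid G (G × G) → Prop
  | unit (g : G) : LiftsTranslation φ ψ 1 (unit g) (unit g)
  | mid {m : K} {p p' : G × G} (h : φ m = ψ (p⁻¹ * p')) : LiftsTranslation φ ψ m (mid p) (mid p')
  | zero (m : K) : LiftsTranslation φ ψ m zero zero

namespace LiftsTranslation

variable {φ : K →* L} {ψ : G × G →* L} {m n : K} {s t r : BisetMonoid G (G × G)}

theorem refl (s : BisetMonoid G (G × G)) : LiftsTranslation φ ψ 1 s s := by
  cases s with
  | unit g => exact .unit g
  | mid p => exact .mid (by simp)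
  | zero => exact .zero 1

theorem inv (h : LiftsTranslation φ ψ m s t) : LiftsTranslation φ ψ m⁻¹ t s := by
  cases h with
  | unit g => simpa using .unit g
  | mid h => exact .mid (by rw [map_inv, h, ← map_inv, mul_inv_rev, inv_inv])
  | zero m => exact .zero _

theorem mul (h : LiftsTranslation φ ψ m s t) (h' : LiftsTranslation φ ψ n t r) :
    LiftsTranslation φ ψ (m * n) s r := by
  cases h with
  | unit g => exact (one_mul n).symm ▸ h'
  | mid h =>
    obtain _ | h' | _ := h'
    exact .mid (by rw [map_mul, h, h', ← map_mul, mul_assoc, mul_inv_cancel_left])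
  | zero m =>
    cases h'
    exact .zero _

theorem map_eq_of_mid {p p' : G × G} (h : LiftsTranslation φ ψ m (.mid p) (.mid p')) :
    φ m = ψ (p⁻¹ * p') := by
  obtain _ | h | _ := h
  exact h

theorem smul {p p' : G × G} (h : LiftsTranslation φ ψ m (.mid p) (.mid p')) (g : G × G) :
    LiftsTranslation φ ψ m (.mid (g • p)) (.mid (g • p')) :=
  .mid (by rw [h.map_eq_of_mid, smul_eq_mul, smul_eq_mul, mul_inv_rev, mul_assoc,
    inv_mul_cancel_left])

theorem mul_left (h : LiftsTranslation φ ψ m s t) (r : BisetMonoid G (G × G)) :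
    LiftsTranslation φ ψ m (r * s) (r * t) := by
  cases h with
  | unit g => exact .refl _
  | mid h =>
    cases r with
    | unit g => exact (LiftsTranslation.mid h).smul (g, 1)
    | mid p => exact .zero m
    | zero => exact .zero m
  | zero m => simpa using .zero m

theorem mul_right (h : LiftsTranslation φ ψ m s t) (r : BisetMonoid G (G × G)) :
    LiftsTranslation φ ψ m (s * r) (t * r) := by
  cases h with
  | unit g => exact .refl _
  | mid h =>
    cases r with
    | unit g => exact (LiftsTranslation.mid h).smul (1, g⁻¹)
    | mid p => exact .zero m
    | zero => exact .zero m
  | zero m => exact .zero m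

theorem eq_zero_iff (h : LiftsTranslation φ ψ m s t) :
    s = BisetMonoid.zero ↔ t = BisetMonoid.zero := by
  cases h <;> simp

theorem eq_one_or_eq_one (h : LiftsTranslation φ ψ m s t) {s' t' : BisetMonoid G (G × G)}
    (h' : LiftsTranslation φ ψ n s' t') (hs : s * s' ≠ BisetMonoid.zero) : m = 1 ∨ n = 1 := by
  cases h <;> cases h' <;> simp_all

theorem map_eq_map (h : LiftsTranslation φ ψ m s t) (h' : LiftsTranslation φ ψ n s t)
    (hs : s ≠ BisetMonoid.zero) : φ m = φ n := by
  cases h with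
  | unit g =>
    cases h'
    rfl
  | mid h =>
    exact h.trans h'.map_eq_of_mid.symm
  | zero m => exact (hs rfl).elim

end LiftsTranslation

variable {X : Type*} [MulAction (G × G) X] (x₀ : X)

/-- The biset homomorphism from `G × G` that sends `1` to `x₀`. -/
def orbitMap : G × G →[G × G] X := ⟨(· • x₀), fun p q => mul_smul p q x₀⟩

@[simp] theorem orbitMap_apply (p : G × G) : orbitMap x₀ p = p • x₀ := rfl

variable {x₀}

theorem exists_liftsTranslation {φ : K →* L} {ψ : G × G →* L}
    (hlift : ∀ p ∈ MulAction.stabilizer (G × G) x₀, ∃ m, φ m = ψ p)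
    {s t : BisetMonoid G (G × G)} (h : map (orbitMap x₀) s = map (orbitMap x₀) t) :
    ∃ m, LiftsTranslation φ ψ m s t := by
  cases s with
  | unit g =>
    obtain rfl := eq_unit_of_map _ h.symm
    exact ⟨1, .unit g⟩
  | mid p =>
    obtain ⟨p', rfl, hp⟩ := exists_eq_mid_of_map _ h.symm
    obtain ⟨m, hm⟩ := hlift (p⁻¹ * p') (by
      rw [MulAction.mem_stabilizer_iff, mul_smul, inv_smul_eq_iff]
      exact hp)
    exact ⟨m, .mid hm⟩
  | zero =>
    cases t <;> first | exact ⟨1, .zero 1⟩ | cases h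

end BisetMonoid

namespace DerivationGraph

open BisetMonoid

variable {A : Type u} {R : Set (FreeMonoid A × FreeMonoid A)} {G K L : Type*} [Group G] [Group K]
  [Group L] {φ : K →* L} {ψ : G × G →* L} {Φ : FreeMonoid A →* BisetMonoid G (G × G)} {l : R → K}

section Lifting

variable (hl : ∀ r : R, LiftsTranslation φ ψ (l r) (Φ r.1.1) (Φ r.1.2))

include hl

theorem liftsTranslation_edgeLabel {x y : DerivationGraph R} (e : x ⟶ y) :
    LiftsTranslation φ ψ (edgeLabel l e) (Φ x) (Φ y) := by
  obtain ⟨w, r, ε, w', rfl, rfl⟩ := e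
  have hΦ : ∀ u v : DerivationGraph R, Φ (u * v) = Φ u * Φ v := map_mul Φ
  rw [hΦ, hΦ, hΦ, hΦ]
  refine (LiftsTranslation.mul_left ?_ _).mul_right _
  cases ε
  · exact (hl r).inv
  · exact hl r

theorem liftsTranslation_pathLabel {x y : DerivationGraph R} (p : Quiver.Path x y) :
    LiftsTranslation φ ψ (pathLabel l p) (Φ x) (Φ y) := by
  induction p with
  | nil => exact pathLabel_nil (R := R) l ▸ .refl _
  | cons p e ih => exact pathLabel_cons l p e ▸ ih.mul (liftsTranslation_edgeLabel hl e)

theorem exists_map_pathLabel_eq {x y : FreeMonoid A} {p q : G × G}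
    (hxy : wordClass R x = wordClass R y) (hx : Φ x = mid p) (hy : Φ y = mid (p * q)) :
    ∃ γ : Quiver.Path (V := DerivationGraph R) x y, φ (pathLabel l γ) = ψ q := by
  obtain ⟨γ⟩ := nonempty_path_of_wordClass_eq hxy
  have hγ := liftsTranslation_pathLabel hl γ
  rw [hx, hy] at hγ
  exact ⟨γ, by rw [hγ.map_eq_of_mid, inv_mul_cancel_left]⟩

theorem isHomotopyRelation_pathLabel {Q : Type*} [Group Q] (θ : K →* Q) :
    IsHomotopyRelation (R := R) fun x _ p q =>
      Φ x ≠ .zero → θ (pathLabel l p) = θ (pathLabel l q) where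
  equivalence _ _ := ⟨fun _ _ => rfl, fun h hx => (h hx).symm, fun h h' hx => (h hx).trans (h' hx)⟩
  interchange {x₁ y₁ x₂ y₂} e₁ e₂ hx := by
    have hne : Φ x₁ * Φ x₂ ≠ .zero := fun h => hx ((map_mul Φ x₁ x₂).trans h)
    have he : edgeLabel l e₁ = 1 ∨ edgeLabel l e₂ = 1 :=
      (liftsTranslation_edgeLabel hl e₁).eq_one_or_eq_one (liftsTranslation_edgeLabel hl e₂) hne
    rw [pathLabel_comp, pathLabel_comp]
    simp only [pathLabel_toPath]
    change θ (edgeLabel l e₁ * edgeLabel l e₂) = θ (edgeLabel l e₂ * edgeLabel l e₁)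
    rcases he with he | he <;> rw [he, one_mul, mul_one]
  act {x y} p q w z h hx := by
    rw [pathLabel_mapPath_act, pathLabel_mapPath_act]
    refine h fun h₀ => hx ?_
    have hΦ : ∀ u v : DerivationGraph R, Φ (u * v) = Φ u * Φ v := map_mul Φ
    exact (hΦ (w * x) z).trans (by rw [hΦ, h₀, BisetMonoid.mul_zero, BisetMonoid.zero_mul])
  comp s p q t h hx := by
    have hne := mt (liftsTranslation_pathLabel hl s).eq_zero_iff.2 hx
    simp only [pathLabel_comp, map_mul, h hne]
  inv p _ := by simp

theorem IsHomotopyBase.map_pathLabel_eq {Q : Type*} [Group Q] {θ : K →* Q}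
    {C : Set (ParallelPair R)} (hC : IsHomotopyBase C)
    (hθ : ∀ c ∈ C, Φ c.1 ≠ .zero → θ (pathLabel l c.2.2.1) = θ (pathLabel l c.2.2.2))
    {x y : DerivationGraph R} (p q : Quiver.Path x y) (hx : Φ x ≠ .zero) :
    θ (pathLabel l p) = θ (pathLabel l q) :=
  hC p q _ (isHomotopyRelation_pathLabel hl θ) hθ hx

/-- The finite set `T` consists of the differences of the labels of the pairs in a finite homotopy
base. -/
theorem exists_finite_pathLabel_mem_normalClosure (h : PresentationFDT R) :
    ∃ T : Set K, T.Finite ∧ T ⊆ φ.ker ∧ ∀ {x y : DerivationGraph R} (p q : Quiver.Path x y),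
      Φ x ≠ .zero → pathLabel l p * (pathLabel l q)⁻¹ ∈ Subgroup.normalClosure T := by
  obtain ⟨C, hfin, hC⟩ := h
  let diff (c : ParallelPair R) : K := pathLabel l c.2.2.1 * (pathLabel l c.2.2.2)⁻¹
  refine ⟨diff '' {c ∈ C | Φ c.1 ≠ .zero}, (hfin.subset (Set.sep_subset _ _)).image _, ?_,
    fun p q hx => ?_⟩
  · rintro _ ⟨c, ⟨-, hx⟩, rfl⟩
    rw [SetLike.mem_coe, MonoidHom.mem_ker, map_mul, map_inv, mul_inv_eq_one]
    exact (liftsTranslation_pathLabel hl c.2.2.1).map_eq_map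
      (liftsTranslation_pathLabel hl c.2.2.2) hx
  · rw [← div_eq_mul_inv, ← QuotientGroup.eq_iff_div_mem]
    refine hC.map_pathLabel_eq hl (θ := QuotientGroup.mk' _) (fun c hc hx => ?_) p q hx
    rw [QuotientGroup.mk'_apply, QuotientGroup.mk'_apply, QuotientGroup.eq_iff_div_mem,
      div_eq_mul_inv]
    exact Subgroup.subset_normalClosure (Set.mem_image_of_mem diff ⟨hc, hx⟩)

end Lifting

end DerivationGraph

section Obstruction

open BisetMonoid DerivationGraph
open scoped commutatorElement

theorem exists_freeMonoidHom_lift {A S T : Type*} [Monoid S] [Monoid T] {ρ : S →* T}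
    (hρ : Function.Surjective ρ) (π : FreeMonoid A →* T) :
    ∃ Φ : FreeMonoid A →* S, ∀ w, ρ (Φ w) = π w := by
  choose s hs using fun a => hρ (π (.of a))
  exact ⟨FreeMonoid.lift s, DFunLike.congr_fun (f := ρ.comp (FreeMonoid.lift s))
    (FreeMonoid.hom_eq hs)⟩

/-- Translations of the base point from the left and from the right commute, and the two ways around
the square that they span are parallel paths whose labels differ by a commutator. -/
theorem HasFDT.exists_commutator_mem_normalClosure {G K L X : Type*} [Group G] [Group K] [Group L]
    [MulAction (G × G) X] [MulAction.IsPretransitive (G × G) X] (h : HasFDT (BisetMonoid G X))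
    {φ : K →* L} {ψ : G × G →* L} {x₀ : X}
    (hlift : ∀ p ∈ MulAction.stabilizer (G × G) x₀, ∃ m, φ m = ψ p) :
    ∃ T : Set K, T.Finite ∧ T ⊆ φ.ker ∧ ∀ c d : G,
      (c, 1) ∈ MulAction.stabilizer (G × G) x₀ → (1, d) ∈ MulAction.stabilizer (G × G) x₀ →
        ∃ m k, φ m = ψ (c, 1) ∧ φ k = ψ (1, d) ∧ ⁅m, k⁆ ∈ Subgroup.normalClosure T := by
  obtain ⟨A, R, -, -, ⟨e⟩, hR⟩ := h
  let π : FreeMonoid A →* BisetMonoid G X := e.toMonoidHom.comp (wordClass R)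
  have hπ : Function.Surjective π := e.surjective.comp PresentedMonoid.surjective_mk
  obtain ⟨Φ, hΦ⟩ := exists_freeMonoidHom_lift
    (map_surjective (orbitMap x₀) (MulAction.surjective_smul (G × G) x₀)) π
  choose l hl using fun r : R => exists_liftsTranslation hlift
    ((hΦ r.1.1).trans ((congrArg e (wordClass_eq_of_mem r.2)).trans (hΦ r.1.2).symm))
  obtain ⟨T, hfin, hker, hT⟩ := exists_finite_pathLabel_mem_normalClosure hl hR
  refine ⟨T, hfin, hker, fun c d hc hd => ?_⟩
  have hpath {x y : FreeMonoid A} {p q : G × G} (hx : Φ x = mid p) (hy : Φ y = mid (p * q))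
      (hq : q ∈ MulAction.stabilizer (G × G) x₀) :
      ∃ γ : Quiver.Path (V := DerivationGraph R) x y, φ (pathLabel l γ) = ψ q := by
    have hxy : π x = π y := by
      rw [← hΦ, ← hΦ, hx, hy, map_mid, map_mid, orbitMap_apply, orbitMap_apply, mul_smul,
        MulAction.mem_stabilizer_iff.1 hq]
    exact exists_map_pathLabel_eq hl (e.injective hxy) hx hy
  obtain ⟨w, hw⟩ := hπ (mid x₀)
  obtain ⟨p, hp, -⟩ := exists_eq_mid_of_map _ ((hΦ w).trans hw)
  obtain ⟨u, hu⟩ := hπ (unit (p.1 * c * p.1⁻¹))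
  obtain ⟨v, hv⟩ := hπ (unit (p.2 * d⁻¹ * p.2⁻¹))
  have huw : Φ (u * w) = mid (p * (c, 1)) := by
    rw [map_mul, eq_unit_of_map _ ((hΦ u).trans hu), hp, unit_mul_mid]
    congr 1
    ext <;> simp
  have hwv : Φ (w * v) = mid (p * (1, d)) := by
    rw [map_mul, eq_unit_of_map _ ((hΦ v).trans hv), hp, mid_mul_unit]
    congr 1
    ext <;> simp [mul_assoc]
  obtain ⟨γ, hγ⟩ := hpath hp huw hc
  obtain ⟨δ, hδ⟩ := hpath hp hwv hd
  obtain ⟨γ', δ', hγ', hδ'⟩ := exists_pathLabel_square l γ δ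
  refine ⟨_, _, hγ, hδ, ?_⟩
  have hmem := hT γ' δ' (by simp [hp])
  rwa [hγ', hδ', mul_inv_rev, ← mul_assoc] at hmem

end Obstruction

/-! ### A central extension of metabelian matrix groups -/

/-- The group of the matrices `!![1, x, z; 0, t, y; 0, 0, 1]` over `k`. -/
@[ext]
structure AffineHeisenberg (k : Type*) [CommRing k] where
  t : kˣ
  x : k
  y : k
  z : k

namespace AffineHeisenberg

variable {k : Type*} [CommRing k]

instance : Mul (AffineHeisenberg k) :=
  ⟨fun m n => ⟨m.t * n.t, n.x + m.x * n.t, m.t * n.y + m.y, n.z + m.x * n.y + m.z⟩⟩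

instance : One (AffineHeisenberg k) := ⟨⟨1, 0, 0, 0⟩⟩

instance : Inv (AffineHeisenberg k) :=
  ⟨fun m => ⟨m.t⁻¹, -m.x * (m.t⁻¹ : kˣ), -(m.t⁻¹ : kˣ) * m.y, m.x * (m.t⁻¹ : kˣ) * m.y - m.z⟩⟩

variable (m n : AffineHeisenberg k)

@[simp] theorem mul_t : (m * n).t = m.t * n.t := rfl
@[simp] theorem mul_x : (m * n).x = n.x + m.x * n.t := rfl
@[simp] theorem mul_y : (m * n).y = m.t * n.y + m.y := rfl
@[simp] theorem mul_z : (m * n).z = n.z + m.x * n.y + m.z := rfl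
@[simp] theorem one_t : (1 : AffineHeisenberg k).t = 1 := rfl
@[simp] theorem one_x : (1 : AffineHeisenberg k).x = 0 := rfl
@[simp] theorem one_y : (1 : AffineHeisenberg k).y = 0 := rfl
@[simp] theorem one_z : (1 : AffineHeisenberg k).z = 0 := rfl
@[simp] theorem inv_t : (m⁻¹).t = m.t⁻¹ := rfl
@[simp] theorem inv_x : (m⁻¹).x = -m.x * (m.t⁻¹ : kˣ) := rfl
@[simp] theorem inv_y : (m⁻¹).y = -(m.t⁻¹ : kˣ) * m.y := rfl
@[simp] theorem inv_z : (m⁻¹).z = m.x * (m.t⁻¹ : kˣ) * m.y - m.z := rfl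

instance : Group (AffineHeisenberg k) :=
  Group.ofLeftAxioms
    (fun a b c => by ext <;> simp <;> ring)
    (fun a => by ext <;> simp)
    (fun a => by ext <;> simp; ring)

/-- The upper left block of a matrix. -/
def upper : AffineHeisenberg k →* AffineHeisenberg k where
  toFun m := ⟨m.t, m.x, 0, 0⟩
  map_one' := rfl
  map_mul' m n := by ext <;> simp

/-- The lower right block of a matrix. -/
def lower : AffineHeisenberg k →* AffineHeisenberg k where
  toFun m := ⟨m.t, 0, m.y, 0⟩
  map_one' := rfl
  map_mul' m n := by ext <;> simp

/-- The determinant of a matrix. -/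
def det : AffineHeisenberg k →* kˣ where
  toFun := t
  map_one' := rfl
  map_mul' _ _ := rfl

theorem exists_upper_lower {m n : AffineHeisenberg k} (h : det m = det n) (hm : upper m = m)
    (hn : lower n = n) : ∃ r : AffineHeisenberg k, upper r = m ∧ lower r = n :=
  ⟨⟨m.t, m.x, n.y, 0⟩, hm, (congrArg (fun t => (⟨t, 0, n.y, 0⟩ : AffineHeisenberg k)) h).trans hn⟩

/-- The group of the unitriangular matrices with `x = y = 0` and `z` in `D`. It is central. -/
def corner (D : AddSubgroup k) : Subgroup (AffineHeisenberg k) where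
  carrier := {m | m.t = 1 ∧ m.x = 0 ∧ m.y = 0 ∧ m.z ∈ D}
  one_mem' := ⟨rfl, rfl, rfl, D.zero_mem⟩
  mul_mem' := by
    rintro m n ⟨ht, hx, hy, hz⟩ ⟨ht', hx', hy', hz'⟩
    simp_all [D.add_mem]
  inv_mem' := by
    rintro m ⟨ht, hx, hy, hz⟩
    simp_all

instance (D : AddSubgroup k) : (corner D).Normal where
  conj_mem := by
    rintro m ⟨ht, hx, hy, hz⟩ n
    refine ⟨by simp [ht], by simp [hx, ht], by simp [hy, ht], ?_⟩
    convert hz using 1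
    simp [hx, hy, ht]
    ring

theorem z_mem_closure_of_mem_normalClosure {T : Set (AffineHeisenberg k)}
    (hT : T ⊆ ((upper (k := k)).prod lower).ker) {m : AffineHeisenberg k}
    (hm : m ∈ Subgroup.normalClosure T) :
    m.z ∈ AddSubgroup.closure (z '' T) := by
  have hle : Subgroup.normalClosure T ≤ corner (AddSubgroup.closure (z '' T)) :=
    Subgroup.normalClosure_le_normal fun r hr => by
      obtain ⟨h, h'⟩ := Prod.ext_iff.1 (MonoidHom.mem_ker.1 (hT hr))
      exact ⟨congrArg t h, congrArg x h, congrArg y h',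
        AddSubgroup.subset_closure (Set.mem_image_of_mem z hr)⟩
  exact (hle hm).2.2.2

open scoped commutatorElement

theorem commutator_z {m n : AffineHeisenberg k} {s r : k} (hm : upper m = ⟨1, s, 0, 0⟩)
    (hm' : lower m = 1) (hn : upper n = 1) (hn' : lower n = ⟨1, 0, r, 0⟩) : ⁅m, n⁆.z = s * r := by
  have ht : m.t = 1 := congrArg t hm
  have hx : m.x = s := congrArg x hm
  have hy : m.y = 0 := congrArg y hm'
  have ht' : n.t = 1 := congrArg t hn
  have hx' : n.x = 0 := congrArg x hn
  have hy' : n.y = r := congrArg y hn'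
  simp [commutatorElement_def, *]

section Representations

variable (t : kˣ)

/-- The representation of the free group of rank two by upper left blocks that sends the first
generator to a dilation and the second one to a translation. -/
def rhoUpper : FreeGroup (Fin 2) →* AffineHeisenberg k :=
  FreeGroup.lift ![⟨t, 0, 0, 0⟩, ⟨1, 1, 0, 0⟩]

/-- The representation of the free group of rank two by lower right blocks that sends the first
generator to a dilation and the second one to a translation. -/
def rhoLower : FreeGroup (Fin 2) →* AffineHeisenberg k :=
  FreeGroup.lift ![⟨t, 0, 0, 0⟩, ⟨1, 0, 1, 0⟩]

theorem upper_rhoUpper (g : FreeGroup (Fin 2)) : upper (rhoUpper t g) = rhoUpper t g := by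
  have h : upper.comp (rhoUpper t) = rhoUpper t := by
    ext i : 1
    fin_cases i <;> simp [rhoUpper, upper]
  exact DFunLike.congr_fun h g

theorem lower_rhoLower (g : FreeGroup (Fin 2)) : lower (rhoLower t g) = rhoLower t g := by
  have h : lower.comp (rhoLower t) = rhoLower t := by
    ext i : 1
    fin_cases i <;> simp [rhoLower, lower]
  exact DFunLike.congr_fun h g

theorem det_rhoUpper_eq_det_rhoLower {c d : FreeGroup (Fin 2)}
    (h : Abelianization.of c = Abelianization.of d) :
    det (rhoUpper t c) = det (rhoLower t d) := by
  have hdet : det.comp (rhoUpper t) = det.comp (rhoLower t) := by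
    ext i : 1
    fin_cases i <;> simp [rhoLower, rhoUpper, det]
  calc det (rhoUpper t c) = Abelianization.lift (det.comp (rhoUpper t)) (.of c) := by simp
    _ = Abelianization.lift (det.comp (rhoUpper t)) (.of d) := by rw [h]
    _ = det (rhoLower t d) := by simp [hdet]

theorem diagonal_pow (n : ℕ) : (⟨t, 0, 0, 0⟩ : AffineHeisenberg k) ^ n = ⟨t ^ n, 0, 0, 0⟩ := by
  induction n with
  | zero => rw [pow_zero, pow_zero]; rfl
  | succ n ih => rw [pow_succ, ih]; ext <;> simp [pow_succ]

theorem rhoUpper_commutator (n : ℕ) :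
    rhoUpper t ⁅FreeGroup.of (0 : Fin 2) ^ n, FreeGroup.of (1 : Fin 2)⁆ =
      ⟨1, ((t⁻¹ : kˣ) : k) ^ n - 1, 0, 0⟩ := by
  rw [map_commutatorElement, map_pow, rhoUpper, FreeGroup.lift_apply_of, FreeGroup.lift_apply_of]
  ext <;> simp [commutatorElement_def, diagonal_pow, sub_eq_neg_add]

theorem rhoLower_commutator :
    rhoLower t ⁅FreeGroup.of (0 : Fin 2), FreeGroup.of (1 : Fin 2)⁆ = ⟨1, 0, t - 1, 0⟩ := by
  rw [map_commutatorElement, rhoLower, FreeGroup.lift_apply_of, FreeGroup.lift_apply_of]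
  ext <;> simp [commutatorElement_def, sub_eq_neg_add]

end Representations

end AffineHeisenberg

/-! ### The monoid `M` does not have finite derivation type -/

theorem HasFDT.of_mulEquiv {S : Type u} {T : Type v} [Monoid S] [Monoid T] (h : HasFDT S)
    (e : S ≃* T) : HasFDT T := by
  obtain ⟨A, R, hA, hfin, ⟨f⟩, hR⟩ := h
  exact ⟨A, R, hA, hfin, ⟨f.trans e⟩, hR⟩

theorem isIntegral_of_forall_pow_sub_one_mem {k : Type*} [CommRing k] {s : Set k} (hs : s.Finite)
    {x : k} (h : ∀ n : ℕ, x ^ n - 1 ∈ AddSubgroup.closure s) : IsIntegral ℤ x := by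
  let N : Submodule ℤ k := Submodule.span ℤ (insert 1 s)
  have hone : (1 : k) ∈ N := Submodule.subset_span (Set.mem_insert 1 s)
  have hclosure : AddSubgroup.closure s ≤ N.toAddSubgroup :=
    (AddSubgroup.closure_le _).2 ((Set.subset_insert 1 s).trans Submodule.subset_span)
  have hpow (n : ℕ) : x ^ n ∈ N := by simpa using N.add_mem (hclosure (h n)) hone
  have hle : (Algebra.adjoin ℤ {x}).toSubmodule ≤ N := by
    rw [Algebra.adjoin_eq_span, Submodule.span_le]
    rintro y hy
    obtain ⟨n, rfl⟩ := Submonoid.mem_closure_singleton.1 hy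
    exact hpow n
  have hN : IsNoetherian ℤ N := isNoetherian_span_of_finite ℤ (hs.insert 1)
  have hadjoin : IsNoetherian ℤ (Algebra.adjoin ℤ {x}).toSubmodule := isNoetherian_of_le hle
  exact isIntegral_of_submodule_noetherian _ hadjoin x (Algebra.self_mem_adjoin_singleton ℤ x)

theorem not_isIntegral_inv_two : ¬ IsIntegral ℤ (2⁻¹ : ℚ) := by
  intro h
  obtain ⟨n, hn⟩ := IsIntegrallyClosed.isIntegral_iff.1 h
  have h2 : (2 * n : ℚ) = 1 := by
    rw [eq_intCast] at hn
    rw [hn]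
    norm_num
  have : (2 * n : ℤ) = 1 := by exact_mod_cast h2
  omega

namespace MonoidM

open AffineHeisenberg
open scoped commutatorElement

theorem exists_finite_pow_sub_one_mul_mem_closure (h : HasFDT Model) {k : Type*} [CommRing k]
    (t : kˣ) : ∃ s : Set k, s.Finite ∧
      ∀ n : ℕ, (((t⁻¹ : kˣ) : k) ^ n - 1) * (t - 1) ∈ AddSubgroup.closure s := by
  have : MulAction.IsPretransitive (FreeGroup (Fin 2) × FreeGroup (Fin 2))
      (TranslationBiset (Abelianization.of (G := FreeGroup (Fin 2)))) :=
    ⟨fun x y => (TranslationBiset.exists_left_smul_eq abelianization_of_surjective x y).imp'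
      (·, 1) fun _ => id⟩
  obtain ⟨T, hfin, hker, hT⟩ := h.exists_commutator_mem_normalClosure
    (φ := (upper (k := k)).prod lower) (ψ := (rhoUpper t).prodMap (rhoLower t)) (x₀ := 1)
    fun p hp => by
      obtain ⟨m, hm, hm'⟩ := exists_upper_lower
        (det_rhoUpper_eq_det_rhoLower t (TranslationBiset.mem_stabilizer_one_iff.1 hp))
        (upper_rhoUpper t p.1) (lower_rhoLower t p.2)
      exact ⟨m, Prod.ext hm hm'⟩
  refine ⟨z '' T, hfin.image z, fun n => ?_⟩
  obtain ⟨m, r, hm, hr, hmem⟩ := hT ⁅FreeGroup.of (0 : Fin 2) ^ n, FreeGroup.of (1 : Fin 2)⁆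
    ⁅FreeGroup.of (0 : Fin 2), FreeGroup.of (1 : Fin 2)⁆
    (TranslationBiset.mem_stabilizer_one_iff.2 (abelianization_of_commutator _ _))
    (TranslationBiset.mem_stabilizer_one_iff.2 (abelianization_of_commutator _ _).symm)
  obtain ⟨hm, hm'⟩ := Prod.ext_iff.1 hm
  obtain ⟨hr, hr'⟩ := Prod.ext_iff.1 hr
  rw [← commutator_z (hm.trans (rhoUpper_commutator t n)) (hm'.trans (map_one (rhoLower t)))
    (hr.trans (map_one (rhoUpper t))) (hr'.trans (rhoLower_commutator t))]
  exact z_mem_closure_of_mem_normalClosure hker hmem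

end MonoidM

theorem not_hasFDT_monoidM : ¬ HasFDT MonoidM := by
  intro h
  obtain ⟨s, hs, hmem⟩ := MonoidM.exists_finite_pow_sub_one_mul_mem_closure
    (h.of_mulEquiv MonoidM.modelEquiv) (Units.mk0 (2 : ℚ) two_ne_zero)
  refine not_isIntegral_inv_two (isIntegral_of_forall_pow_sub_one_mem hs fun n => ?_)
  convert hmem n using 1
  simp only [Units.val_inv_eq_inv_val, Units.val_mk0]
  ring

theorem theorem1 :
    (∃ H₁ H₂ H₃ : Set MonoidM,
      H₁ ≠ H₂ ∧ H₁ ≠ H₃ ∧ H₂ ≠ H₃ ∧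
      {H : Set MonoidM | IsHClass H} = {H₁, H₂, H₃} ∧
      (∀ x ∈ H₁, Nonempty (SchutzenbergerGroup x ≃* Unit)) ∧
      (∀ x ∈ H₂, Nonempty
        (SchutzenbergerGroup x ≃* Multiplicative (FreeAbelianGroup (Fin 2)))) ∧
      (∀ x ∈ H₃, Nonempty (SchutzenbergerGroup x ≃* FreeGroup (Fin 2)))) ∧
    (∀ x : MonoidM, HasFiniteCompleteRewriting (SchutzenbergerGroup x) ∧
      HasFDT (SchutzenbergerGroup x)) ∧
    ¬ HasFDT MonoidM ∧
    ¬ HasFiniteCompleteRewriting MonoidM := by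
  refine ⟨MonoidM.exists_hClasses, fun x => ?_, not_hasFDT_monoidM,
    fun h => not_hasFDT_monoidM h.hasFDT⟩
  have h := MonoidM.hasFiniteCompleteRewriting_schutzenbergerGroup x
  exact ⟨h, h.hasFDT⟩
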